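/- Let $N\ge 1$ and $D,k\ge 0$ be integers (with $0^0=1$). For a permutation $\pi\in\mathcal S_N$ let $B(\pi)=\sum_{i=1}^N|\pi(i)\rangle\langle i|$, and for an $N\times N$ unitary $U$ let $U^{\otimes k,k}=U^{\otimes k}\otimes(U^*)^{\otimes k}$, where $U^*$ is the entrywise complex conjugate; $\|\cdot\|_\infty$ denotes the operator norm. A probability distribution $\nu$ on $\mathcal S_N$ is a classical $(N,D,\lambda,k)$ tensor product expander (TPE) if $|\operatorname{supp}\nu|\le D$, $\lambda<1$ and $$\Bigl\|\mathbb E_{\pi\sim\nu}\bigl[B(\pi)^{\otimes k}\bigr]-\mathbb E_{\pi\sim\mathcal S_N}\bigl[B(\pi)^{\otimes k}\bigr]\Bigr\|_\infty\le\lambda ,$$ the second expectation being over the uniform distribution on $\mathcal S_N$. A probability distribution $\nu$ on the unitary group $\mathcal U(N)$ is a quantum $(N,D,\lambda,k)$-TPE if $|\operatorname{supp}\nu|\le D$, $\lambda<1$ and $$\Bigl\|\mathbb E_{U\sim\nu}\bigl[U^{\otimes k,k}\bigr]-\mathbb E_{U\sim\mathcal U(N)}\bigl[U^{\otimes k,k}\bigr]\Bigr\|_\infty\le\lambda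 ,$$ the second expectation being over the Haar probability measure. Let $\omega=e^{2\pi i/N}$ and let $\mathcal F=\frac1{\sqrt N}\sum_{m,n=1}^N\omega^{mn}|m\rangle\langle n|$ be the $N$-dimensional Fourier transform. Let $\nu_C$ be a classical $(N,D,1-\epsilon_C,2k)$-TPE, and for $0<p<1$ put $\nu_Q=p\,\nu_C+(1-p)\,\delta_{\mathcal F}$, a distribution on $\mathcal U(N)$, where $\pi$ is identified with $B(\pi)$ and $\delta_{\mathcal F}$ is the point mass at $\mathcal F$. Suppose that $$\epsilon_A:=1-\frac{2(2k)^{4k}}{\sqrt N}>0 .$$ Then for every $0<p<1$, $\nu_Q$ is a quantum $(N,D+1,1-\epsilon_Q,k)$-TPE for some $$\epsilon_Q\ \ge\ \frac{\epsilon_A}{12}\min(p\,\epsilon_C,\,1-p)\ >\ 0 ,$$ and if $|\operatorname{supp}\nu_C|=D$ then $|\operatorname{supp}\nu_Q|=D+1$. Over $0<p<1$ this lower bound is maximal at $p=1/(1+\epsilon_C)\in(0,1)$, and for this $p$ the distribution $\nu_Q$ is a quantum $(N,D+1,1-\epsilon_Q,k)$-TPE for some $\epsilon_Q\ge\epsilon_A\epsilon_C/24$.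 -/

import Mathlib

open MeasureTheory
open scoped Kronecker

noncomputable section

namespace TPE

/-- The group `𝒰(N)` of `N × N` complex unitary matrices. -/
abbrev U (N : ℕ) : Type := Matrix.unitaryGroup (Fin N) ℂ

/-- The Borel `σ`-algebra on `𝒰(N)`. -/
instance instMeasurableSpaceU (N : ℕ) : MeasurableSpace (U N) := borel _

instance instBorelSpaceU (N : ℕ) : BorelSpace (U N) := ⟨rfl⟩

instance instCompactSpaceU (N : ℕ) : CompactSpace (U N) := by
  apply isCompact_iff_compactSpace.mp
  have hK : IsCompact (Set.pi Set.univ fun _ : Fin N =>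
      Set.pi Set.univ fun _ : Fin N => Metric.closedBall (0 : ℂ) 1) :=
    isCompact_univ_pi fun _ => isCompact_univ_pi fun _ => isCompact_closedBall _ _
  refine IsCompact.of_isClosed_subset hK ?_ ?_
  · have : ((Matrix.unitaryGroup (Fin N) ℂ : Set (Matrix (Fin N) (Fin N) ℂ))) =
        {A | A * star A = 1} := by
      ext A
      exact Matrix.mem_unitaryGroup_iff
    rw [this]
    exact isClosed_eq (by fun_prop) continuous_const
  · intro A hA i _ j _
    simpa using entry_norm_bound_of_unitary hA i j

/-- The Haar probability measure on the compact group `𝒰(N)`. -/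
def haar (N : ℕ) : Measure (U N) := Measure.haarMeasure ⊤

/-- The `k`-fold tensor power `A^{⊗k}`, in the product basis `|i₁, …, i_k⟩`. -/
def tensorPow {N : ℕ} (k : ℕ) (A : Matrix (Fin N) (Fin N) ℂ) :
    Matrix (Fin k → Fin N) (Fin k → Fin N) ℂ :=
  Matrix.of fun i j => ∏ a, A (i a) (j a)

/-- `A^{⊗k,k} = A^{⊗k} ⊗ (A^*)^{⊗k}`, where `A^*` is the entrywise complex conjugate. -/
def tensorPow₂ {N : ℕ} (k : ℕ) (A : Matrix (Fin N) (Fin N) ℂ) :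
    Matrix ((Fin k → Fin N) × (Fin k → Fin N)) ((Fin k → Fin N) × (Fin k → Fin N)) ℂ :=
  tensorPow k A ⊗ₖ tensorPow k (A.map star)

/-- The Schatten `∞`-norm, i.e. the operator norm on `ℂⁿ` with its Euclidean norm. -/
def schattenInf {n : Type*} [Fintype n] [DecidableEq n] (A : Matrix n n ℂ) : ℝ :=
  ‖Matrix.toEuclideanCLM (𝕜 := ℂ) A‖

/-- The permutation matrix `B(π) = ∑ᵢ |π(i)⟩⟨i|`. -/
def B {N : ℕ} (π : Equiv.Perm (Fin N)) : Matrix (Fin N) (Fin N) ℂ :=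
  Matrix.of fun a b => if a = π b then 1 else 0

theorem B_mem {N : ℕ} (π : Equiv.Perm (Fin N)) : B π ∈ Matrix.unitaryGroup (Fin N) ℂ := by
  rw [Matrix.mem_unitaryGroup_iff']
  ext a b
  simp [B, Matrix.mul_apply, Matrix.star_apply, Matrix.one_apply, apply_ite, π.injective.eq_iff,
    eq_comm]

/-- The permutation matrix `B(π)` as an element of `𝒰(N)`. -/
def permU {N : ℕ} (π : Equiv.Perm (Fin N)) : U N := ⟨B π, B_mem π⟩

/-- `𝔼_{π ∼ ν} [B(π)^{⊗k}]`. -/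
def classicalMoment {N : ℕ} (k : ℕ) (ν : PMF (Equiv.Perm (Fin N))) :
    Matrix (Fin k → Fin N) (Fin k → Fin N) ℂ :=
  ∑ π, (ν π).toReal • tensorPow k (B π)

/-- `𝔼_{U ∼ μ} [U^{⊗k,k}]`, the integral being taken entry by entry. -/
def quantumMoment {N : ℕ} (k : ℕ) (μ : Measure (U N)) :
    Matrix ((Fin k → Fin N) × (Fin k → Fin N)) ((Fin k → Fin N) × (Fin k → Fin N)) ℂ :=
  Matrix.of fun i j => ∫ V : U N, tensorPow₂ k (V : Matrix (Fin N) (Fin N) ℂ) i j ∂μ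

/-- `ν` is a classical `(N, D, lam, k)` tensor product expander. -/
structure IsClassicalTPE (N D : ℕ) (lam : ℝ) (k : ℕ) (ν : PMF (Equiv.Perm (Fin N))) : Prop where
  support_le : ν.support.encard ≤ D
  norm_le : schattenInf (classicalMoment k ν -
    classicalMoment k (PMF.uniformOfFintype (Equiv.Perm (Fin N)))) ≤ lam
  lam_lt_one : lam < 1

/-- `ν` is a quantum `(N, D, lam, k)` tensor product expander. -/
structure IsQuantumTPE (N D : ℕ) (lam : ℝ) (k : ℕ) (ν : PMF (U N)) : Prop where
  support_le : ν.support.encard ≤ D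
  norm_le : schattenInf (quantumMoment k ν.toMeasure - quantumMoment k (haar N)) ≤ lam
  lam_lt_one : lam < 1

/-- The `N`-dimensional Fourier transform `N^{-1/2} ∑_{m,n=1}^N ω^{mn} |m⟩⟨n|`, `ω = e^{2πi/N}`.
The basis state `|m⟩`, `1 ≤ m ≤ N`, has index `m - 1` in `Fin N`. -/
def fourier (N : ℕ) : Matrix (Fin N) (Fin N) ℂ :=
  Matrix.of fun m n =>
    (1 / (Real.sqrt N : ℂ)) *
      Complex.exp (2 * Real.pi * Complex.I / N) ^ (((m : ℕ) + 1) * ((n : ℕ) + 1))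

theorem fourier_mem (N : ℕ) : fourier N ∈ Matrix.unitaryGroup (Fin N) ℂ := by
  rw [Matrix.mem_unitaryGroup_iff]
  ext a b
  have hN : N ≠ 0 := fun h => by subst h; exact a.elim0
  have hN' : (N : ℂ) ≠ 0 := Nat.cast_ne_zero.mpr hN
  set w : ℂ := Complex.exp (2 * Real.pi * Complex.I / N) with hw
  have hprim : IsPrimitiveRoot w N := Complex.isPrimitiveRoot_exp N hN
  have hw0 : w ≠ 0 := Complex.exp_ne_zero _
  have hconj : star w = w⁻¹ := by
    rw [hw, ← Complex.exp_neg, Complex.star_def, ← Complex.exp_conj]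
    congr 1
    simp [neg_div, map_ofNat]
  have hs : (1 / (Real.sqrt N : ℂ)) * star (1 / (Real.sqrt N : ℂ)) = (N : ℂ)⁻¹ := by
    have h : ((Real.sqrt N : ℝ) : ℂ) * ((Real.sqrt N : ℝ) : ℂ) = N := by
      rw [← Complex.ofReal_mul, Real.mul_self_sqrt (Nat.cast_nonneg N)]; simp
    simp only [one_div, Complex.star_def, map_inv₀, Complex.conj_ofReal]
    rw [← mul_inv, h]
  set z : ℂ := w ^ ((a : ℕ) + 1) * (w⁻¹) ^ ((b : ℕ) + 1) with hz
  have hterm : ∀ n : Fin N, fourier N a n * star (fourier N) n b =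
      (N : ℂ)⁻¹ * (z * z ^ (n : ℕ)) := by
    intro n
    simp only [Matrix.star_apply, fourier, Matrix.of_apply, star_mul', star_pow]
    rw [← hw, hconj, mul_mul_mul_comm, hs, ← pow_succ', hz, mul_pow, ← pow_mul, ← pow_mul]
  rw [Matrix.mul_apply, Finset.sum_congr rfl fun n _ => hterm n, ← Finset.mul_sum,
    ← Finset.mul_sum, Fin.sum_univ_eq_sum_range (fun i => z ^ i) N, Matrix.one_apply]
  split_ifs with hab
  · have hz1 : z = 1 := by
      rw [hz, hab, ← mul_pow, mul_inv_cancel₀ hw0, one_pow]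
    simp [hz1, hN']
  · have hz1 : z ≠ 1 := by
      intro h
      apply hab
      rw [hz, inv_pow, ← div_eq_mul_inv, div_eq_one_iff_eq (pow_ne_zero _ hw0), pow_succ, pow_succ]
        at h
      exact Fin.ext (hprim.pow_inj a.2 b.2 (mul_right_cancel₀ hw0 h))
    have hzN : z ^ N = 1 := by
      rw [hz, mul_pow, ← pow_mul, ← pow_mul, mul_comm _ N, mul_comm _ N, pow_mul, pow_mul,
        inv_pow, hprim.pow_eq_one]
      simp
    have hg : ∑ i ∈ Finset.range N, z ^ i = 0 := by
      have h := geom_sum_mul z N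
      rw [hzN, sub_self] at h
      exact (mul_eq_zero.mp h).resolve_right (sub_ne_zero.mpr hz1)
    simp [hg]

/-- The Fourier transform as an element of `𝒰(N)`. -/
def fourierU (N : ℕ) : U N := ⟨fourier N, fourier_mem N⟩

/-- The mixture `p μ + (1 - p) ν` of two discrete probability distributions. -/
def mix {α : Type*} (p : ℝ) (hp : p ∈ Set.Icc (0 : ℝ) 1) (μ ν : PMF α) : PMF α :=
  ⟨fun a => ENNReal.ofReal p * μ a + ENNReal.ofReal (1 - p) * ν a, by
    have h : ∑' a, (ENNReal.ofReal p * μ a + ENNReal.ofReal (1 - p) * ν a) = 1 := by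
      rw [ENNReal.tsum_add, ENNReal.tsum_mul_left, ENNReal.tsum_mul_left, μ.tsum_coe, ν.tsum_coe,
        mul_one, mul_one, ← ENNReal.ofReal_add hp.1 (sub_nonneg.mpr hp.2)]
      simp
    exact h ▸ ENNReal.summable.hasSum⟩

/-- `ν_Q = p ν_C + (1 - p) δ_F`, where a distribution `ν_C` on permutations is regarded as the
distribution of `B(π)`, `π ∼ ν_C`, on `𝒰(N)`. -/
def nuQ {N : ℕ} (p : ℝ) (hp : p ∈ Set.Icc (0 : ℝ) 1) (νC : PMF (Equiv.Perm (Fin N))) : PMF (U N) :=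
  mix p hp (νC.map permU) (PMF.pure (fourierU N))

/-- `ε_A = 1 - 2 (2k)^{4k} / √N`. -/
def epsA (N k : ℕ) : ℝ := 1 - 2 * (2 * (k : ℝ)) ^ (4 * k) / Real.sqrt N

/-- The bound `(ε_A / 12) min(p ε_C, 1 - p)`. -/
def gapBound (N k : ℕ) (εC p : ℝ) : ℝ := epsA N k / 12 * min (p * εC) (1 - p)

end TPE

end

/-!
Averaging a unitary representation over a group gives the projection onto the invariant vectors.
So `V = im 𝔼_{𝒰(N)}[U^{⊗k,k}]` is contained in `W = im 𝔼_{𝒮_N}[B(π)^{⊗2k}]`; everything fixes `V`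
pointwise, `𝔼_{ν_C}` contracts `Wᗮ` by `1 - ε_C`, and the mixture `ν_Q` has a gap as soon as `𝓕`
moves every vector of `W ⊖ V` by a definite angle.

`W` consists of the functions of `i : [2k] → [N]` that depend only on the set partition `ker i`; it
has an orthogonal basis of at most `(2k)^{2k}` vectors, one for each partition of `[2k]`. Write a
vector of `W ⊖ V` in this basis. If the partition is a pairing of the `k` factors `U` with the `k`
factors `U^*`, orthogonality to the `𝒰(N)`-invariant vector of the pairing makes the component
small. If a block meets only factors of one kind, translating that block by `1` multiplies the
Fourier kernel by a phase that is almost always nontrivial, so that `𝓕^{⊗k,k}` has a small matrix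
element. Every other partition has fewer than `k` blocks, and between two of these the matrix
element is small because the vectors have few entries.
-/

noncomputable section

namespace TPE

section Mixing

variable {H : Type*} [NormedAddCommGroup H] [InnerProductSpace ℂ H]

theorem norm_sq_convexCombination (p : ℝ) (x y : H) :
    ‖p • x + (1 - p) • y‖ ^ 2 =
      p * ‖x‖ ^ 2 + (1 - p) * ‖y‖ ^ 2 - p * (1 - p) * ‖x - y‖ ^ 2 := by
  simp only [RCLike.real_smul_eq_coe_smul (K := ℂ)]
  rw [norm_add_sq (𝕜 := ℂ), norm_sub_sq (𝕜 := ℂ), inner_smul_real_left, inner_smul_real_right,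
    norm_smul, norm_smul]
  simp only [RCLike.norm_ofReal, mul_pow, sq_abs, RCLike.smul_re]
  ring

theorem half_min_le_mul_one_sub {p ε : ℝ} (hp : p ∈ Set.Ioo (0 : ℝ) 1) (hε : ε ≤ 1) :
    min (p * ε) (1 - p) / 2 ≤ p * (1 - p) := by
  obtain ⟨h0, h1⟩ := hp
  rcases le_total p (1 / 2) with h | h
  · nlinarith [min_le_left (p * ε) (1 - p)]
  · nlinarith [min_le_right (p * ε) (1 - p)]

variable {X Y P G : H →L[ℂ] H} {p εC εA : ℝ}

theorem mul_norm_sq_le_of_re_inner_le (hY : ∀ v, ‖Y v‖ = ‖v‖) {w : H}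
    (hXw : ‖X w - P w‖ ≤ ‖w - P w‖)
    (hgap : (inner ℂ (P w) (Y (P w))).re ≤ (1 - εA) * ‖P w‖ ^ 2) :
    2 * εA * ‖P w‖ ^ 2 ≤ 3 * ‖X w - Y w‖ ^ 2 + 6 * ‖w - P w‖ ^ 2 := by
  have hmoved : 2 * εA * ‖P w‖ ^ 2 ≤ ‖P w - Y (P w)‖ ^ 2 := by
    rw [norm_sub_sq (𝕜 := ℂ), hY, RCLike.re_to_complex]
    linarith
  have htri : ‖P w - Y (P w)‖ ≤ ‖X w - Y w‖ + 2 * ‖w - P w‖ := calc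
    ‖P w - Y (P w)‖ = ‖(X w - Y w) - (X w - P w) + Y (w - P w)‖ := by
      rw [map_sub]
      congr 1
      abel
    _ ≤ ‖X w - Y w‖ + ‖X w - P w‖ + ‖Y (w - P w)‖ :=
      (norm_add_le _ _).trans (by gcongr; exact norm_sub_le _ _)
    _ ≤ ‖X w - Y w‖ + 2 * ‖w - P w‖ := by
      rw [hY]
      linarith
  calc 2 * εA * ‖P w‖ ^ 2 ≤ (‖X w - Y w‖ + 2 * ‖w - P w‖) ^ 2 := hmoved.trans (by gcongr)
    _ ≤ _ := by nlinarith [sq_nonneg (‖X w - Y w‖ - ‖w - P w‖)]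

variable [CompleteSpace H]

theorem norm_sq_eq_add_of_isStarProjection (hP : IsStarProjection P) (v : H) :
    ‖v‖ ^ 2 = ‖P v‖ ^ 2 + ‖v - P v‖ ^ 2 := by
  obtain ⟨K, _, rfl⟩ := isStarProjection_iff_eq_starProjection.1 hP
  rw [K.norm_sq_eq_add_norm_sq_starProjection v, Submodule.starProjection_orthogonal_val]

theorem norm_apply_sub_le (hP : IsStarProjection P) (hXP : X * P = P) (hX : ‖X - P‖ ≤ 1 - εC)
    (w : H) : ‖X w - P w‖ ≤ (1 - εC) * ‖w - P w‖ := by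
  have hXPw : X (P w) = P w := congr($hXP w)
  have hPPw : P (P w) = P w := congr($hP.isIdempotentElem w)
  simpa [hXPw, hPPw] using (X - P).le_of_opNorm_le hX (w - P w)

theorem norm_sq_apply_le_of_norm_sub_le (hP : IsStarProjection P) (hXP : X * P = P)
    (hPX : P * X = P) (hX : ‖X - P‖ ≤ 1 - εC) (hC0 : 0 < εC) (w : H) :
    ‖X w‖ ^ 2 ≤ ‖w‖ ^ 2 - εC * ‖w - P w‖ ^ 2 := by
  have hC1 : 0 ≤ 1 - εC := (norm_nonneg _).trans hX
  have hPXw : P (X w) = P w := congr($hPX w)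
  have hsq : ‖X w - P w‖ ^ 2 ≤ (1 - εC) * ‖w - P w‖ ^ 2 := calc
    ‖X w - P w‖ ^ 2 ≤ ((1 - εC) * ‖w - P w‖) ^ 2 := by
      gcongr
      exact norm_apply_sub_le hP hXP hX w
    _ = (1 - εC) * ‖w - P w‖ ^ 2 * (1 - εC) := by ring
    _ ≤ (1 - εC) * ‖w - P w‖ ^ 2 := mul_le_of_le_one_right (by positivity) (by linarith)
  rw [norm_sq_eq_add_of_isStarProjection hP (X w), norm_sq_eq_add_of_isStarProjection hP w, hPXw]
  linarith

theorem norm_sq_convexCombination_le (hp : p ∈ Set.Ioo (0 : ℝ) 1) (hC0 : 0 < εC) (hA1 : εA ≤ 1)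
    (hP : IsStarProjection P) (hXP : X * P = P) (hPX : P * X = P) (hX : ‖X - P‖ ≤ 1 - εC)
    (hY : ∀ v, ‖Y v‖ = ‖v‖) {w : H}
    (hgap : (inner ℂ (P w) (Y (P w))).re ≤ (1 - εA) * ‖P w‖ ^ 2) :
    ‖(p • X + (1 - p) • Y) w‖ ^ 2 ≤ (1 - εA / 6 * min (p * εC) (1 - p)) * ‖w‖ ^ 2 := by
  have hC1 : 0 ≤ 1 - εC := (norm_nonneg _).trans hX
  have hXw : ‖X w - P w‖ ≤ ‖w - P w‖ := (norm_apply_sub_le hP hXP hX w).trans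
    (mul_le_of_le_one_left (norm_nonneg _) (by linarith))
  have hcontract := norm_sq_apply_le_of_norm_sub_le hP hXP hPX hX hC0 w
  have hmoved := mul_norm_sq_le_of_re_inner_le hY hXw hgap
  have hpyth := norm_sq_eq_add_of_isStarProjection hP w
  have hweight := half_min_le_mul_one_sub hp (by linarith : εC ≤ 1)
  have hmC : min (p * εC) (1 - p) ≤ p * εC := min_le_left _ _
  have hm0 : 0 < min (p * εC) (1 - p) := lt_min (mul_pos hp.1 hC0) (sub_pos.2 hp.2)
  simp only [add_apply, smul_apply, norm_sq_convexCombination, hY]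
  generalize min (p * εC) (1 - p) = m at *
  have hgain : εA / 6 * ‖w‖ ^ 2 ≤ ‖w - P w‖ ^ 2 + ‖X w - Y w‖ ^ 2 / 2 := by
    nlinarith [sq_nonneg ‖w - P w‖, sq_nonneg ‖X w - Y w‖]
  have hdecay : m * ‖w - P w‖ ^ 2 + m * (‖X w - Y w‖ ^ 2 / 2) ≤
      p * εC * ‖w - P w‖ ^ 2 + p * (1 - p) * ‖X w - Y w‖ ^ 2 := by
    nlinarith [sq_nonneg ‖w - P w‖, sq_nonneg ‖X w - Y w‖]
  nlinarith [mul_le_mul_of_nonneg_left hcontract hp.1.le, mul_le_mul_of_nonneg_left hgain hm0.le]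

theorem norm_convexCombination_sub_le (hp : p ∈ Set.Ioo (0 : ℝ) 1) (hC0 : 0 < εC) (hA0 : 0 ≤ εA)
    (hA1 : εA ≤ 1) (hG : IsStarProjection G) (hP : IsStarProjection P) (hXP : X * P = P)
    (hPX : P * X = P) (hX : ‖X - P‖ ≤ 1 - εC) (hY : ∀ v, ‖Y v‖ = ‖v‖) (hYG : Y * G = G)
    (hGP : G * P = G)
    (hgap : ∀ v, G v = 0 → P v = v → (inner ℂ v (Y v)).re ≤ (1 - εA) * ‖v‖ ^ 2) :
    ‖p • X + (1 - p) • Y - G‖ ≤ 1 - εA / 12 * min (p * εC) (1 - p) := by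
  have hm0 : 0 ≤ min (p * εC) (1 - p) := (lt_min (mul_pos hp.1 hC0) (sub_pos.2 hp.2)).le
  have hm1 : min (p * εC) (1 - p) ≤ 1 := (min_le_right _ _).trans (by linarith [hp.1])
  have hPG : P * G = G := by
    simpa [hP.isSelfAdjoint.star_eq, hG.isSelfAdjoint.star_eq] using congr(star $hGP)
  have hXG : X * G = G := by rw [← hPG, ← mul_assoc, hXP]
  have hZG : (p • X + (1 - p) • Y) * G = G := by
    rw [add_mul, smul_mul_assoc, smul_mul_assoc, hXG, hYG, ← add_smul, add_sub_cancel, one_smul]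
  refine ContinuousLinearMap.opNorm_le_bound _ (by nlinarith) fun v => ?_
  set w := v - G v with hw
  have hGw : G w = 0 := by
    have hGGv : G (G v) = G v := congr($hG.isIdempotentElem v)
    rw [hw, map_sub, hGGv, sub_self]
  have hZw : (p • X + (1 - p) • Y - G) v = (p • X + (1 - p) • Y) w := by
    have hZGv : (p • X + (1 - p) • Y) (G v) = G v := congr($hZG v)
    rw [hw, map_sub, hZGv, sub_apply]
  have hwv : ‖w‖ ≤ ‖v‖ := by
    have hpyth := norm_sq_eq_add_of_isStarProjection hG v
    exact le_of_sq_le_sq (by nlinarith [sq_nonneg ‖G v‖]) (norm_nonneg _)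
  have hsq := norm_sq_convexCombination_le hp hC0 hA1 hP hXP hPX hX hY (w := w)
    (hgap _ (congr($hGP w).trans hGw) congr($hP.isIdempotentElem w))
  rw [hZw]
  generalize min (p * εC) (1 - p) = m at *
  have hfactor : 0 ≤ 1 - εA / 12 * m := by nlinarith
  calc ‖(p • X + (1 - p) • Y) w‖ ≤ (1 - εA / 12 * m) * ‖w‖ := by
        refine le_of_sq_le_sq (hsq.trans ?_) (by positivity)
        rw [mul_pow]
        gcongr
        nlinarith [sq_nonneg (εA / 12 * m)]
    _ ≤ (1 - εA / 12 * m) * ‖v‖ := by gcongr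

end Mixing

section Average

theorem star_mul_eq_of_forall_mul_eq {G A : Type*} [Group G] [Monoid A] [StarMul A]
    {ρ : G →* unitary A} {a : A} (ha : ∀ g, (ρ g : A) * a = a) (g : G) :
    star a * (ρ g : A) = star a := by
  simpa [map_inv, ← Unitary.star_eq_inv] using congr(star $(ha g⁻¹))

variable {A : Type*} [NormedRing A] [NormedSpace ℝ A] [IsScalarTower ℝ A A] [SMulCommClass ℝ A A]

theorem integral_mul_eq_of_forall [CompleteSpace A] {X : Type*} [MeasurableSpace X] {μ : Measure X}
    [IsProbabilityMeasure μ] {f : X → A} {a : A} (hf : Integrable f μ) (h : ∀ x, f x * a = a) :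
    (∫ x, f x ∂μ) * a = a := by
  simp [← integral_mul_const_of_integrable hf, h]

theorem mul_integral_eq_of_forall [CompleteSpace A] {X : Type*} [MeasurableSpace X] {μ : Measure X}
    [IsProbabilityMeasure μ] {f : X → A} {a : A} (hf : Integrable f μ) (h : ∀ x, a * f x = a) :
    a * ∫ x, f x ∂μ = a := by
  simp [← integral_const_mul_of_integrable hf, h]

variable [StarRing A] {G : Type*} [Group G] [MeasurableSpace G] [MeasurableMul G] {μ : Measure G}
  [μ.IsMulLeftInvariant] {ρ : G →* unitary A}

theorem mul_average_eq (hρ : Integrable (fun g => (ρ g : A)) μ) (h : G) :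
    (ρ h : A) * ∫ g, (ρ g : A) ∂μ = ∫ g, (ρ g : A) ∂μ := by
  rw [← integral_const_mul_of_integrable hρ,
    ← integral_mul_left_eq_self (fun g => (ρ g : A)) h]
  simp only [map_mul, Submonoid.coe_mul]

variable [CompleteSpace A] [IsProbabilityMeasure μ]

theorem isStarProjection_average (hρ : Integrable (fun g => (ρ g : A)) μ) :
    IsStarProjection (∫ g, (ρ g : A) ∂μ) := by
  have hfix := mul_average_eq hρ
  have hstar : star (∫ g, (ρ g : A) ∂μ) * ∫ g, (ρ g : A) ∂μ = star (∫ g, (ρ g : A) ∂μ) :=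
    mul_integral_eq_of_forall hρ (star_mul_eq_of_forall_mul_eq hfix)
  exact ⟨integral_mul_eq_of_forall hρ hfix, IsSelfAdjoint.star_iff.1 (hstar ▸ .star_mul_self _)⟩

theorem average_mul_eq (hρ : Integrable (fun g => (ρ g : A)) μ) (h : G) :
    (∫ g, (ρ g : A) ∂μ) * (ρ h : A) = ∫ g, (ρ g : A) ∂μ := by
  simpa only [(isStarProjection_average hρ).isSelfAdjoint.star_eq] using
    star_mul_eq_of_forall_mul_eq (mul_average_eq hρ) h

end Average

section Tensor

variable {ι m n o R : Type*} [Fintype ι] [CommSemiring R]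

/-- The tensor product of a family of matrices, in the product basis. -/
def tensor (K : ι → Matrix m n R) : Matrix (ι → m) (ι → n) R :=
  Matrix.of fun i j => ∏ x, K x (i x) (j x)

theorem tensor_apply (K : ι → Matrix m n R) (i : ι → m) (j : ι → n) :
    tensor K i j = ∏ x, K x (i x) (j x) := rfl

theorem tensor_mul [DecidableEq ι] [Fintype n] (K : ι → Matrix m n R) (L : ι → Matrix n o R) :
    tensor K * tensor L = tensor fun x => K x * L x := by
  ext i j
  simp_rw [Matrix.mul_apply, tensor_apply, Matrix.mul_apply, Fintype.prod_sum,
    Finset.prod_mul_distrib]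

theorem tensor_one [DecidableEq n] : tensor (fun _ : ι => (1 : Matrix n n R)) = 1 := by
  ext i j
  simp only [tensor_apply, Matrix.one_apply, Finset.prod_ite_zero, Finset.prod_const_one,
    Finset.mem_univ, true_imp_iff, funext_iff]

theorem star_tensor [StarRing R] (K : ι → Matrix n n R) :
    star (tensor K) = tensor fun x => star (K x) := by
  ext i j
  simp only [Matrix.star_apply, tensor_apply, star_prod]

variable {N : ℕ} [DecidableEq ι] [Fintype n] [DecidableEq n]

/-- `A ↦ A^{⊗ι} ⊗ (A^*)^{⊗ι}`, with all the tensor factors indexed by the single type `ι ⊕ ι`. -/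
def mixedPow (ι n : Type*) [Fintype ι] [DecidableEq ι] [Fintype n] [DecidableEq n] :
    Matrix n n ℂ →⋆* Matrix (ι ⊕ ι → n) (ι ⊕ ι → n) ℂ where
  toFun A := tensor (Sum.elim (fun _ => A) fun _ => A.map star)
  map_one' := by
    rw [← tensor_one]
    refine congrArg tensor (funext ?_)
    rintro (_ | _)
    · rfl
    · exact Matrix.map_one _ (star_zero ℂ) (star_one ℂ)
  map_mul' A B := by
    rw [tensor_mul]
    refine congrArg tensor (funext ?_)
    rintro (_ | _)
    · rfl
    · exact Matrix.map_mul (f := starRingEnd ℂ)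
  map_star' A := by
    rw [star_tensor]
    refine congrArg tensor (funext ?_)
    rintro (_ | _) <;> rfl

theorem mixedPow_eq_tensor (A : Matrix n n ℂ) :
    mixedPow ι n A = tensor (Sum.elim (fun _ => A) fun _ => A.map star) := rfl

theorem mixedPow_apply (A : Matrix n n ℂ) (i j : ι ⊕ ι → n) :
    mixedPow ι n A i j =
      (∏ x, A (i (.inl x)) (j (.inl x))) * ∏ x, star (A (i (.inr x)) (j (.inr x))) := by
  simp [mixedPow_eq_tensor, tensor_apply, Fintype.prod_sum_type]

theorem tensorPow₂_eq_submatrix (k : ℕ) (A : Matrix (Fin N) (Fin N) ℂ) :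
    tensorPow₂ k A = (mixedPow (Fin k) (Fin N) A).submatrix
      (Equiv.sumArrowEquivProdArrow _ _ _).symm (Equiv.sumArrowEquivProdArrow _ _ _).symm := by
  ext i j
  simp only [tensorPow₂, tensorPow, Matrix.kroneckerMap_apply, Matrix.submatrix_apply,
    mixedPow_apply]
  rfl

theorem map_star_B (π : Equiv.Perm (Fin N)) : (B π).map star = B π := by
  ext a b
  simp [B, apply_ite]

/-- A `2k`-tuple as a tuple indexed by `Fin k ⊕ Fin k`. -/
def tupleEquiv (N k : ℕ) : (Fin (2 * k) → Fin N) ≃ (Fin k ⊕ Fin k → Fin N) :=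
  (finSumFinEquiv.trans (finCongr (two_mul k).symm)).symm.arrowCongr (Equiv.refl _)

theorem tensorPow_B_eq_submatrix (k : ℕ) (π : Equiv.Perm (Fin N)) :
    tensorPow (2 * k) (B π) =
      (mixedPow (Fin k) (Fin N) (B π)).submatrix (tupleEquiv N k) (tupleEquiv N k) := by
  ext i j
  simp only [tensorPow, Matrix.of_apply, mixedPow_eq_tensor, map_star_B, Matrix.submatrix_apply,
    tensor_apply]
  rw [← Equiv.prod_comp (finSumFinEquiv.trans (finCongr (two_mul k).symm))]
  refine Finset.prod_congr rfl fun x _ => ?_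
  rcases x with x | x <;> rfl

theorem schattenInf_submatrix {m : Type*} [Fintype m] [DecidableEq m] (e : m ≃ n)
    (A : Matrix n n ℂ) : schattenInf (A.submatrix e e) = schattenInf A := by
  let U := LinearIsometryEquiv.piLpCongrLeft 2 ℂ ℂ e
  have hconj : Matrix.toEuclideanCLM (𝕜 := ℂ) (A.submatrix e e) =
      (U.symm : _ →L[ℂ] _) ∘L Matrix.toEuclideanCLM (𝕜 := ℂ) A ∘L (U : _ →L[ℂ] _) := by
    ext v x
    simp [Matrix.ofLp_toEuclideanCLM, Matrix.submatrix_mulVec_equiv, U]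
    rfl
  simp only [schattenInf, hconj, ContinuousLinearMap.opNorm_linearIsometryEquiv_comp,
    ContinuousLinearMap.opNorm_comp_linearIsometryEquiv]

theorem schattenInf_submatrix_sub {m : Type*} [Fintype m] [DecidableEq m] (e : m ≃ n)
    (A B : Matrix n n ℂ) : schattenInf (A.submatrix e e - B.submatrix e e) =
      ‖Matrix.toEuclideanCLM (𝕜 := ℂ) A - Matrix.toEuclideanCLM (𝕜 := ℂ) B‖ := by
  rw [← map_sub]
  exact schattenInf_submatrix e (A - B)

/-- The Hilbert space `(ℂⁿ)^{⊗(ι ⊕ ι)}`. -/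
abbrev TensorSpace (ι n : Type*) : Type _ := EuclideanSpace ℂ (ι ⊕ ι → n)

/-- The operators on `(ℂⁿ)^{⊗(ι ⊕ ι)}`. -/
abbrev TensorOp (ι n : Type*) [Fintype ι] [Fintype n] : Type _ :=
  TensorSpace ι n →L[ℂ] TensorSpace ι n

/-- The unitary representation `V ↦ V^{⊗ι} ⊗ (V^*)^{⊗ι}` of the unitary group. -/
def mixedRep (ι n : Type*) [Fintype ι] [DecidableEq ι] [Fintype n] [DecidableEq n] :
    Matrix.unitaryGroup n ℂ →* unitary (TensorOp ι n) :=
  (Unitary.map ((StarMonoidHom.ofClass (Matrix.toEuclideanCLM (𝕜 := ℂ))).comp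
    (mixedPow ι n))).toMonoidHom

theorem coe_mixedRep (V : Matrix.unitaryGroup n ℂ) :
    (mixedRep ι n V : TensorOp ι n) = Matrix.toEuclideanCLM (𝕜 := ℂ) (mixedPow ι n V) := rfl

end Tensor

section Moment

variable {N : ℕ}

/-- `𝔼_{V ∼ μ} [V^{⊗k,k}]` as a Bochner integral of operators on `(ℂᴺ)^{⊗2k}`. -/
def moment (k : ℕ) (μ : Measure (U N)) : TensorOp (Fin k) (Fin N) :=
  ∫ V, (mixedRep (Fin k) (Fin N) V : TensorOp (Fin k) (Fin N)) ∂μ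

theorem continuous_mixedRep (ι n : Type*) [Fintype ι] [DecidableEq ι] [Fintype n]
    [DecidableEq n] :
    Continuous fun V : Matrix.unitaryGroup n ℂ =>
      (mixedRep ι n V : TensorOp ι n) := by
  have hpow : Continuous fun V : Matrix.unitaryGroup n ℂ => mixedPow ι n (V : Matrix n n ℂ) := by
    refine continuous_matrix fun i j => ?_
    simp only [mixedPow_apply]
    have hentry (a b : n) : Continuous fun V : Matrix.unitaryGroup n ℂ => (V : Matrix n n ℂ) a b :=
      continuous_subtype_val.matrix_elem a b
    exact (continuous_finsetProd _ fun x _ => hentry _ _).mul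
      (continuous_finsetProd _ fun x _ => (hentry _ _).star)
  exact (LinearMap.continuous_of_finiteDimensional
    (Matrix.toEuclideanCLM (n := ι ⊕ ι → n) (𝕜 := ℂ)).toAlgEquiv.toLinearMap).comp hpow

theorem integrable_mixedRep (k : ℕ) (μ : Measure (U N)) [IsFiniteMeasure μ] :
    Integrable (fun V => (mixedRep (Fin k) (Fin N) V : TensorOp (Fin k) (Fin N))) μ :=
  (continuous_mixedRep _ _).integrable_of_hasCompactSupport (HasCompactSupport.of_compactSpace _)

theorem quantumMoment_eq_submatrix (k : ℕ) (μ : Measure (U N)) [IsFiniteMeasure μ] :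
    quantumMoment k μ = ((Matrix.toEuclideanCLM (𝕜 := ℂ)).symm (moment k μ)).submatrix
      (Equiv.sumArrowEquivProdArrow _ _ _).symm (Equiv.sumArrowEquivProdArrow _ _ _).symm := by
  ext i j
  let entry := LinearMap.toContinuousLinearMap (Matrix.entryLinearMap ℂ ℂ
    ((Equiv.sumArrowEquivProdArrow _ _ _).symm i) ((Equiv.sumArrowEquivProdArrow _ _ _).symm j) ∘ₗ
      (Matrix.toEuclideanCLM (n := Fin k ⊕ Fin k → Fin N) (𝕜 := ℂ)).symm.toAlgEquiv.toLinearMap)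
  have hentry := entry.integral_comp_comm (integrable_mixedRep k μ)
  refine Eq.trans (integral_congr_ae (.of_forall fun V => ?_)) hentry
  change _ = (Matrix.toEuclideanCLM (𝕜 := ℂ)).symm (mixedRep (Fin k) (Fin N) V :
    TensorOp (Fin k) (Fin N)) _ _
  rw [coe_mixedRep, StarAlgEquiv.symm_apply_apply]
  exact congr_fun₂ (tensorPow₂_eq_submatrix k _) i j

theorem schattenInf_quantumMoment_sub (k : ℕ) (μ ν : Measure (U N)) [IsFiniteMeasure μ]
    [IsFiniteMeasure ν] :
    schattenInf (quantumMoment k μ - quantumMoment k ν) = ‖moment k μ - moment k ν‖ := by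
  rw [quantumMoment_eq_submatrix, quantumMoment_eq_submatrix,
    schattenInf_submatrix_sub, StarAlgEquiv.apply_symm_apply, StarAlgEquiv.apply_symm_apply]

instance instMeasurableSpacePerm : MeasurableSpace (Equiv.Perm (Fin N)) := ⊤

instance instDiscreteMeasurableSpacePerm : DiscreteMeasurableSpace (Equiv.Perm (Fin N)) :=
  ⟨fun _ => trivial⟩

theorem moment_map_permU (k : ℕ) (ν : PMF (Equiv.Perm (Fin N))) :
    moment k (ν.map permU).toMeasure =
      ∫ π, (mixedRep (Fin k) (Fin N) (permU π) : TensorOp (Fin k) (Fin N)) ∂ν.toMeasure := by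
  rw [moment, ← PMF.toMeasure_map permU ν (measurable_of_finite _),
    integral_map (measurable_of_finite _).aemeasurable
      (continuous_mixedRep _ _).aestronglyMeasurable]

theorem classicalMoment_eq_submatrix (k : ℕ) (ν : PMF (Equiv.Perm (Fin N))) :
    classicalMoment (2 * k) ν =
      ((Matrix.toEuclideanCLM (𝕜 := ℂ)).symm (moment k (ν.map permU).toMeasure)).submatrix
        (tupleEquiv N k) (tupleEquiv N k) := by
  rw [moment_map_permU, PMF.integral_eq_sum, map_sum]
  ext i j
  simp only [classicalMoment, tensorPow_B_eq_submatrix, Matrix.sum_apply, Matrix.submatrix_apply]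
  refine Finset.sum_congr rfl fun π _ => ?_
  rw [coe_mixedRep, ← Complex.coe_smul (ν π).toReal (Matrix.toEuclideanCLM (𝕜 := ℂ)
    (mixedPow (Fin k) (Fin N) (permU π))), map_smul, StarAlgEquiv.symm_apply_apply]
  rfl

theorem schattenInf_classicalMoment_sub (k : ℕ) (μ ν : PMF (Equiv.Perm (Fin N))) :
    schattenInf (classicalMoment (2 * k) μ - classicalMoment (2 * k) ν) =
      ‖moment k (μ.map permU).toMeasure - moment k (ν.map permU).toMeasure‖ := by
  rw [classicalMoment_eq_submatrix, classicalMoment_eq_submatrix,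
    schattenInf_submatrix_sub, StarAlgEquiv.apply_symm_apply, StarAlgEquiv.apply_symm_apply]

instance instIsProbabilityMeasureHaar : IsProbabilityMeasure (haar N) :=
  ⟨Measure.haarMeasure_self (K₀ := (⊤ : TopologicalSpace.PositiveCompacts (U N)))⟩

instance instIsMulLeftInvariantHaar : (haar N).IsMulLeftInvariant := by
  unfold haar; infer_instance

instance instIsMulLeftInvariantUniform {G : Type*} [Group G] [Fintype G] [MeasurableSpace G]
    [DiscreteMeasurableSpace G] :
    (PMF.uniformOfFintype G).toMeasure.IsMulLeftInvariant := by
  classical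
  refine ⟨fun g => Measure.ext fun s hs => ?_⟩
  rw [Measure.map_apply (measurable_const_mul g) hs,
    PMF.toMeasure_uniformOfFintype_apply _ .of_discrete,
    PMF.toMeasure_uniformOfFintype_apply _ .of_discrete,
    ← Set.toFinset_card, ← Set.toFinset_card]
  congr 2
  exact Finset.card_equiv (Equiv.mulLeft g) fun x => by simp

/-- Permutations as a subgroup of `𝒰(N)`. -/
def permUHom (N : ℕ) : Equiv.Perm (Fin N) →* U N where
  toFun := permU
  map_one' := Subtype.ext <| by
    ext a b
    simp only [permU, B, Matrix.of_apply, Equiv.Perm.one_apply]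
    rfl
  map_mul' π τ := Subtype.ext <| by
    ext a b
    simp only [permU, B, Submonoid.coe_mul, Matrix.mul_apply, Matrix.of_apply, Equiv.Perm.mul_apply,
      mul_ite, mul_one, mul_zero, Finset.sum_ite_eq', Finset.mem_univ, if_true]
    rfl

theorem mixedRep_mul_moment_haar (k : ℕ) (V : U N) :
    (mixedRep (Fin k) (Fin N) V : TensorOp (Fin k) (Fin N)) * moment k (haar N) =
      moment k (haar N) :=
  mul_average_eq (integrable_mixedRep k _) V

theorem moment_haar_mul_mixedRep (k : ℕ) (V : U N) :
    moment k (haar N) * (mixedRep (Fin k) (Fin N) V : TensorOp (Fin k) (Fin N)) =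
      moment k (haar N) :=
  average_mul_eq (integrable_mixedRep k _) V

theorem isStarProjection_moment_haar (N k : ℕ) : IsStarProjection (moment k (haar N)) :=
  isStarProjection_average (integrable_mixedRep k _)

theorem mul_moment_map_permU {k : ℕ} {A : TensorOp (Fin k) (Fin N)}
    (hA : ∀ π, A * (mixedRep (Fin k) (Fin N) (permU π) : TensorOp (Fin k) (Fin N)) = A)
    (ν : PMF (Equiv.Perm (Fin N))) :
    A * moment k (ν.map permU).toMeasure = A := by
  rw [moment_map_permU]
  exact mul_integral_eq_of_forall (.of_finite) hA

theorem moment_map_permU_mul {k : ℕ} {A : TensorOp (Fin k) (Fin N)}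
    (hA : ∀ π, (mixedRep (Fin k) (Fin N) (permU π) : TensorOp (Fin k) (Fin N)) * A = A)
    (ν : PMF (Equiv.Perm (Fin N))) :
    moment k (ν.map permU).toMeasure * A = A := by
  rw [moment_map_permU]
  exact integral_mul_eq_of_forall (.of_finite) hA

/-- The average of `B(π)^{⊗k,k}` over all permutations `π`. -/
def permMoment (N k : ℕ) : TensorOp (Fin k) (Fin N) :=
  moment k ((PMF.uniformOfFintype (Equiv.Perm (Fin N))).map permU).toMeasure

theorem integrable_permRep (k : ℕ) (μ : Measure (Equiv.Perm (Fin N))) [IsFiniteMeasure μ] :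
    Integrable (fun π => ((mixedRep (Fin k) (Fin N)).comp (permUHom N) π :
      TensorOp (Fin k) (Fin N))) μ :=
  .of_finite

theorem permMoment_eq_average (N k : ℕ) :
    permMoment N k =
      ∫ π, ((mixedRep (Fin k) (Fin N)).comp (permUHom N) π : TensorOp (Fin k) (Fin N))
        ∂(PMF.uniformOfFintype (Equiv.Perm (Fin N))).toMeasure :=
  moment_map_permU k _

theorem mixedRep_permU_mul_permMoment (k : ℕ) (π : Equiv.Perm (Fin N)) :
    (mixedRep (Fin k) (Fin N) (permU π) : TensorOp (Fin k) (Fin N)) *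
      permMoment N k = permMoment N k := by
  rw [permMoment_eq_average]
  exact mul_average_eq (integrable_permRep k _) π

theorem permMoment_mul_mixedRep_permU (k : ℕ) (π : Equiv.Perm (Fin N)) :
    permMoment N k * (mixedRep (Fin k) (Fin N) (permU π) : TensorOp (Fin k) (Fin N)) =
      permMoment N k := by
  rw [permMoment_eq_average]
  exact average_mul_eq (integrable_permRep k _) π

theorem isStarProjection_permMoment (N k : ℕ) : IsStarProjection (permMoment N k) := by
  rw [permMoment_eq_average]
  exact isStarProjection_average (integrable_permRep k _)

theorem mix_toMeasure {α : Type*} [MeasurableSpace α] (p : ℝ) (hp : p ∈ Set.Icc (0 : ℝ) 1)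
    (μ ν : PMF α) : (mix p hp μ ν).toMeasure =
      ENNReal.ofReal p • μ.toMeasure + ENNReal.ofReal (1 - p) • ν.toMeasure := by
  ext s hs
  simp only [Measure.coe_add, Measure.coe_smul, Pi.add_apply, Pi.smul_apply, smul_eq_mul,
    PMF.toMeasure_apply _ hs]
  rw [← ENNReal.tsum_mul_left, ← ENNReal.tsum_mul_left, ← ENNReal.tsum_add]
  refine tsum_congr fun x => ?_
  by_cases hx : x ∈ s
  · simp only [Set.indicator_of_mem hx]; rfl
  · simp [hx]

theorem moment_mix (k : ℕ) (p : ℝ) (hp : p ∈ Set.Icc (0 : ℝ) 1) (μ ν : PMF (U N)) :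
    moment k (mix p hp μ ν).toMeasure =
      p • moment k μ.toMeasure + (1 - p) • moment k ν.toMeasure := by
  have hrep (μ : PMF (U N)) := integrable_mixedRep k μ.toMeasure
  rw [moment, mix_toMeasure, integral_add_measure ((hrep μ).smul_measure ENNReal.ofReal_ne_top)
    ((hrep ν).smul_measure ENNReal.ofReal_ne_top), integral_smul_measure, integral_smul_measure,
    ENNReal.toReal_ofReal hp.1, ENNReal.toReal_ofReal (sub_nonneg.2 hp.2)]
  rfl

theorem moment_pure (k : ℕ) (V : U N) :
    moment k (PMF.pure V).toMeasure = mixedRep (Fin k) (Fin N) V := by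
  rw [moment, PMF.toMeasure_pure, integral_dirac]

theorem moment_nuQ (k : ℕ) (p : ℝ) (hp : p ∈ Set.Icc (0 : ℝ) 1)
    (νC : PMF (Equiv.Perm (Fin N))) :
    moment k (nuQ p hp νC).toMeasure =
      p • moment k (νC.map permU).toMeasure +
        (1 - p) • (mixedRep (Fin k) (Fin N) (fourierU N) : TensorOp (Fin k) (Fin N)) := by
  rw [nuQ, moment_mix, moment_pure]

theorem norm_moment_nuQ_sub_le {k : ℕ} {εA εC p : ℝ} {νC : PMF (Equiv.Perm (Fin N))}
    (hp : p ∈ Set.Ioo (0 : ℝ) 1) (hC0 : 0 < εC) (hA0 : 0 ≤ εA) (hA1 : εA ≤ 1)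
    (hC : ‖moment k (νC.map permU).toMeasure - permMoment N k‖ ≤ 1 - εC)
    (hgap : ∀ v, moment k (haar N) v = 0 → permMoment N k v = v →
      (inner ℂ v ((mixedRep (Fin k) (Fin N) (fourierU N) : TensorOp (Fin k) (Fin N)) v)).re ≤
        (1 - εA) * ‖v‖ ^ 2) :
    ‖moment k (nuQ p (Set.Ioo_subset_Icc_self hp) νC).toMeasure - moment k (haar N)‖ ≤
      1 - εA / 12 * min (p * εC) (1 - p) := by
  rw [moment_nuQ]
  exact norm_convexCombination_sub_le hp hC0 hA0 hA1 (isStarProjection_moment_haar N k)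
    (isStarProjection_permMoment N k)
    (moment_map_permU_mul (mixedRep_permU_mul_permMoment k) νC)
    (mul_moment_map_permU (permMoment_mul_mixedRep_permU k) νC) hC
    (ContinuousLinearMap.norm_map_of_mem_unitary (mixedRep (Fin k) (Fin N) (fourierU N)).2)
    (mixedRep_mul_moment_haar k _)
    (mul_moment_map_permU (fun π => moment_haar_mul_mixedRep k (permU π)) _) hgap

end Moment

section Partition

variable {ι : Type*}

theorem exists_perm_comp_eq {α : Type*} [Finite ι] {i j : ι → α}
    (h : Setoid.ker i = Setoid.ker j) : ∃ π : Equiv.Perm α, π ∘ i = j := by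
  obtain ⟨π, hπ⟩ := Equiv.Perm.exists_extending_pair (Setoid.kerLift i) (Quotient.lift j h.le)
    (Setoid.kerLift_injective i) ((Setoid.lift_injective_iff_ker_eq_of_le h.le).2 h.symm)
  exact ⟨π, funext fun x => hπ (Quotient.mk _ x)⟩

theorem setoid_out_injective :
    Function.Injective fun (r : Setoid ι) (x : ι) => (Quotient.mk r x).out := by
  refine Function.LeftInverse.injective (g := Setoid.ker) fun r => Setoid.ext fun x y => ?_
  exact Quotient.out_inj.trans Quotient.eq

theorem card_quotient_le [Fintype ι] (r : Setoid ι) : Nat.card (Quotient r) ≤ Fintype.card ι :=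
  (Nat.card_le_card_of_surjective _ Quotient.mk_surjective).trans_eq Nat.card_eq_fintype_card

variable {α : Type*} [Fintype ι] [DecidableEq ι] [Fintype α]

open Classical in
/-- The tuples with `i x = i y` if and only if `r x y`. -/
def exactTuples (α : Type*) [Fintype α] (r : Setoid ι) : Finset (ι → α) :=
  Finset.univ.filter fun i => Setoid.ker i = r

open Classical in
/-- The tuples with `i x = i y` whenever `r x y`. -/
def constTuples (α : Type*) [Fintype α] (r : Setoid ι) : Finset (ι → α) :=
  Finset.univ.filter fun i => r ≤ Setoid.ker i

theorem mem_exactTuples {r : Setoid ι} {i : ι → α} : i ∈ exactTuples α r ↔ Setoid.ker i = r := by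
  simp [exactTuples]

theorem mem_constTuples {r : Setoid ι} {i : ι → α} : i ∈ constTuples α r ↔ r ≤ Setoid.ker i := by
  simp [constTuples]

theorem exactTuples_subset_constTuples (r : Setoid ι) : exactTuples α r ⊆ constTuples α r :=
  fun _ hi => mem_constTuples.2 (mem_exactTuples.1 hi).ge

theorem card_constTuples (r : Setoid ι) :
    (constTuples α r).card = Fintype.card α ^ Nat.card (Quotient r) := by
  classical
  rw [constTuples, ← Fintype.card_subtype, Fintype.card_congr (Setoid.liftEquiv r),
    Fintype.card_fun, Nat.card_eq_fintype_card]

theorem card_exactTuples (r : Setoid ι) :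
    (exactTuples α r).card = (Fintype.card α).descFactorial (Nat.card (Quotient r)) := by
  classical
  have e : {i : ι → α // Setoid.ker i = r} ≃ (Quotient r ↪ α) :=
    { toFun := fun i => ⟨Quotient.lift i.1 i.2.ge,
        (Setoid.lift_injective_iff_ker_eq_of_le i.2.ge).2 i.2⟩
      invFun := fun f => ⟨f ∘ Quotient.mk r, Setoid.ext fun x y =>
        f.injective.eq_iff.trans Quotient.eq⟩
      left_inv := fun i => rfl
      right_inv := fun f => by ext ⟨x⟩; rfl }
  rw [exactTuples, ← Fintype.card_subtype, Fintype.card_congr e, Fintype.card_embedding_eq,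
    Nat.card_eq_fintype_card]

theorem mul_pow_le_mul_descFactorial_add (N q : ℕ) :
    N * N ^ q ≤ N * N.descFactorial q + q ^ 2 * N ^ q := by
  induction q with
  | zero => simp
  | succ q ih =>
    have hN : N ≤ (N - q) + q := by omega
    calc N * N ^ (q + 1) = N * N ^ q * N := by ring
      _ ≤ N * N ^ q * ((N - q) + q) := by gcongr
      _ = (N * N ^ q) * (N - q) + q * N ^ (q + 1) := by ring
      _ ≤ (N * N.descFactorial q + q ^ 2 * N ^ q) * (N - q) + q * N ^ (q + 1) := by gcongr
      _ ≤ N * ((N - q) * N.descFactorial q) + (q ^ 2 * N ^ q) * N + q * N ^ (q + 1) := by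
        rw [add_mul, mul_comm (N - q), ← mul_assoc]
        gcongr
        exact Nat.sub_le N q
      _ ≤ N * N.descFactorial (q + 1) + (q + 1) ^ 2 * N ^ (q + 1) := by
        rw [Nat.descFactorial_succ]
        nlinarith [Nat.zero_le (q * N ^ (q + 1)), Nat.zero_le (N ^ (q + 1)), pow_succ N q]

theorem card_mul_card_constTuples_le (r : Setoid ι) :
    Fintype.card α * (constTuples α r).card ≤ Fintype.card α * (exactTuples α r).card +
      Nat.card (Quotient r) ^ 2 * (constTuples α r).card := by
  rw [card_constTuples, card_exactTuples]
  exact mul_pow_le_mul_descFactorial_add _ _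

theorem card_constTuples_le [Nonempty α] {r : Setoid ι}
    (hr : 2 * Nat.card (Quotient r) ^ 2 ≤ Fintype.card α) :
    (constTuples α r).card ≤ 2 * (exactTuples α r).card := by
  have hα : 0 < Fintype.card α := Fintype.card_pos
  have hcount := card_mul_card_constTuples_le (α := α) r
  have := Nat.mul_le_mul_right (constTuples α r).card hr
  refine Nat.le_of_mul_le_mul_left ?_ hα
  linarith

theorem card_mul_card_constTuples_sdiff_le [DecidableEq α] (r : Setoid ι) :
    Fintype.card α * (constTuples α r \ exactTuples α r).card ≤
      Nat.card (Quotient r) ^ 2 * (constTuples α r).card := by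
  have hsplit := Finset.card_sdiff_add_card_eq_card (exactTuples_subset_constTuples (α := α) r)
  have hcount := card_mul_card_constTuples_le (α := α) r
  nlinarith

/-- A balanced function that is constant on the generic part of `constTuples α r` is small there,
as the non-generic part is a small fraction of it. -/
theorem card_mul_sum_exactTuples_le [Nonempty α] {r : Setoid ι}
    (hr : 2 * Nat.card (Quotient r) ^ 2 ≤ Fintype.card α) {a : (ι → α) → ℂ} {c : ℂ}
    (hc : ∀ i ∈ exactTuples α r, a i = c) (h0 : ∑ i ∈ constTuples α r, a i = 0) :
    Fintype.card α * ∑ i ∈ exactTuples α r, ‖a i‖ ^ 2 ≤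
      2 * (Nat.card (Quotient r) : ℝ) ^ 2 * ∑ i, ‖a i‖ ^ 2 := by
  classical
  set E := exactTuples α r
  set C := constTuples α r
  set q := Nat.card (Quotient r)
  have hEsum : ∑ i ∈ E, ‖a i‖ ^ 2 = E.card * ‖c‖ ^ 2 := by
    rw [Finset.sum_congr rfl fun i hi => by rw [hc i hi], Finset.sum_const, nsmul_eq_mul]
  have hbalance : (E.card : ℂ) * c = -∑ i ∈ C \ E, a i := by
    rw [← Finset.sum_sdiff (exactTuples_subset_constTuples r), Finset.sum_congr rfl hc,
      Finset.sum_const, nsmul_eq_mul] at h0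
    exact eq_neg_of_add_eq_zero_right h0
  have hcs : (E.card * ‖c‖) ^ 2 ≤ (C \ E).card * ∑ i, ‖a i‖ ^ 2 := calc
    (E.card * ‖c‖) ^ 2 = ‖∑ i ∈ C \ E, a i‖ ^ 2 := by
      rw [← norm_neg (∑ i ∈ C \ E, a i), ← hbalance, norm_mul, Complex.norm_natCast]
    _ ≤ (∑ i ∈ C \ E, ‖a i‖) ^ 2 := by gcongr; exact norm_sum_le _ _
    _ ≤ (C \ E).card * ∑ i ∈ C \ E, ‖a i‖ ^ 2 := sq_sum_le_card_mul_sum_sq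
    _ ≤ (C \ E).card * ∑ i, ‖a i‖ ^ 2 := by
      gcongr
      exact Finset.subset_univ _
  rcases E.card.eq_zero_or_pos with hE | hE
  · rw [hEsum, hE]
    simp only [Nat.cast_zero, zero_mul, mul_zero]
    positivity
  have hcard : (Fintype.card α * (C \ E).card : ℝ) ≤ q ^ 2 * (2 * E.card) := by
    exact_mod_cast (card_mul_card_constTuples_sdiff_le r).trans
      (Nat.mul_le_mul_left _ (card_constTuples_le hr))
  refine le_of_mul_le_mul_left ?_ (Nat.cast_pos (α := ℝ).2 hE)
  calc (E.card : ℝ) * (Fintype.card α * ∑ i ∈ E, ‖a i‖ ^ 2)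
      = Fintype.card α * (E.card * ‖c‖) ^ 2 := by rw [hEsum]; ring
    _ ≤ Fintype.card α * ((C \ E).card * ∑ i, ‖a i‖ ^ 2) := by gcongr
    _ = (Fintype.card α * (C \ E).card) * ∑ i, ‖a i‖ ^ 2 := by ring
    _ ≤ (q ^ 2 * (2 * E.card)) * ∑ i, ‖a i‖ ^ 2 := by gcongr
    _ = E.card * (2 * q ^ 2 * ∑ i, ‖a i‖ ^ 2) := by ring

instance instFintypeSetoid : Fintype (Setoid ι) :=
  Fintype.ofInjective _ setoid_out_injective

theorem card_setoid_le : Fintype.card (Setoid ι) ≤ Fintype.card ι ^ Fintype.card ι :=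
  (Fintype.card_le_of_injective _ setoid_out_injective).trans_eq (Fintype.card_fun)

end Partition

section Pairing

variable {ι : Type*}

/-- The set partition `{{inr x, inl (σ x)} : x ∈ ι}` of `ι ⊕ ι`. -/
def pairing (σ : Equiv.Perm ι) : Setoid (ι ⊕ ι) := Setoid.ker (Sum.elim id σ)

theorem card_quotient_pairing [Fintype ι] (σ : Equiv.Perm ι) :
    Nat.card (Quotient (pairing σ)) = Fintype.card ι := by
  rw [← Nat.card_eq_fintype_card]
  exact Nat.card_congr (Setoid.quotientKerEquivOfSurjective _ fun x => ⟨.inl x, rfl⟩)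

theorem pairing_le_ker {α : Type*} {σ : Equiv.Perm ι} {i : ι ⊕ ι → α} :
    pairing σ ≤ Setoid.ker i ↔ ∀ x, i (.inl (σ x)) = i (.inr x) := by
  refine ⟨fun h x => h (x := .inl (σ x)) (y := .inr x) rfl, fun h => ?_⟩
  have hi : i = (i ∘ .inl) ∘ Sum.elim id σ := by
    funext x
    rcases x with x | x
    · rfl
    · exact (h x).symm
  intro x y hxy
  rw [Setoid.ker_def, hi]
  exact congrArg (i ∘ .inl) hxy

theorem exists_eq_pairing_or_card_quotient_lt [Fintype ι] {r : Setoid (ι ⊕ ι)}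
    (hl : ∀ y, ∃ x, r (.inl x) y) (hr : ∀ y, ∃ x, r (.inr x) y) :
    (∃ σ, r = pairing σ) ∨ Nat.card (Quotient r) < Fintype.card ι := by
  have surj_l : Function.Surjective fun x : ι => Quotient.mk r (.inl x) :=
    Quotient.ind fun y => (hl y).imp fun x h => Quotient.sound h
  have surj_r : Function.Surjective fun x : ι => Quotient.mk r (.inr x) :=
    Quotient.ind fun y => (hr y).imp fun x h => Quotient.sound h
  rw [← Nat.card_eq_fintype_card, or_iff_not_imp_right, not_lt]
  intro hcard
  let el := Equiv.ofBijective _ (surj_l.bijective_of_nat_card_le hcard)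
  let er := Equiv.ofBijective _ (surj_r.bijective_of_nat_card_le hcard)
  refine ⟨er.trans el.symm, ?_⟩
  have hmk : Quotient.mk r = el ∘ Sum.elim id (er.trans el.symm) := by
    funext x
    rcases x with x | x
    · rfl
    · exact (el.apply_symm_apply _).symm
  refine Setoid.ext fun x y => ?_
  rw [pairing, Setoid.ker_def, ← el.injective.eq_iff]
  exact Quotient.eq.symm.trans (by rw [hmk]; rfl)

end Pairing

section Indicator

variable {n : Type*} [DecidableEq n]

/-- The unnormalised uniform superposition of the basis vectors in `A`. -/
def indVec (A : Finset n) : EuclideanSpace ℂ n :=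
  WithLp.toLp 2 fun i => if i ∈ A then 1 else 0

theorem indVec_apply (A : Finset n) (i : n) : indVec A i = if i ∈ A then 1 else 0 := rfl

theorem indVec_add_indVec_sdiff {A C : Finset n} (h : C ⊆ A) :
    indVec C + indVec (A \ C) = indVec A := by
  ext i
  by_cases hi : i ∈ C
  · simp [indVec_apply, hi, h hi]
  · simp [indVec_apply, hi]

variable [Fintype n]

theorem inner_indVec (A : Finset n) (v : EuclideanSpace ℂ n) :
    inner ℂ (indVec A) v = ∑ i ∈ A, v i := by
  simp [PiLp.inner_apply, indVec_apply, apply_ite, Finset.sum_ite_mem]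

theorem norm_sq_indVec (A : Finset n) : ‖indVec A‖ ^ 2 = A.card := by
  simp [EuclideanSpace.norm_sq_eq, indVec_apply, apply_ite, Finset.sum_ite_mem]

theorem toEuclideanCLM_indVec_apply (T : Matrix n n ℂ) (A : Finset n) (i : n) :
    Matrix.toEuclideanCLM (𝕜 := ℂ) T (indVec A) i = ∑ j ∈ A, T i j := by
  simp [Matrix.ofLp_toEuclideanCLM, Matrix.mulVec, dotProduct, indVec_apply, Finset.sum_ite_mem]

theorem inner_indVec_toEuclideanCLM_indVec (T : Matrix n n ℂ) (A C : Finset n) :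
    inner ℂ (indVec A) (Matrix.toEuclideanCLM (𝕜 := ℂ) T (indVec C)) =
      ∑ i ∈ A, ∑ j ∈ C, T i j := by
  rw [inner_indVec]
  exact Finset.sum_congr rfl fun i _ => toEuclideanCLM_indVec_apply T C i

theorem norm_indVec_le_mul {A C : Finset n} {c : ℝ} (hc : 0 ≤ c)
    (h : (A.card : ℝ) ≤ c ^ 2 * C.card) : ‖indVec A‖ ≤ c * ‖indVec C‖ := by
  refine le_of_sq_le_sq ?_ (by positivity)
  rwa [mul_pow, norm_sq_indVec, norm_sq_indVec]

end Indicator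

section Fourier

variable {N : ℕ}

theorem pow_val_add {ζ : ℂ} (hζ : ζ ^ N = 1) (s t : Fin N) :
    ζ ^ ((s + t : Fin N) : ℕ) = ζ ^ (s : ℕ) * ζ ^ (t : ℕ) := by
  rw [Fin.val_add, ← pow_add]
  exact (pow_eq_pow_mod _ hζ).symm

theorem card_mul_pow_eq_one_le {ζ : ℂ} (hζ : IsPrimitiveRoot ζ N) (c : ℂ) {s : ℕ}
    (hs : 0 < s) : (Finset.univ.filter fun t : Fin N => c * (ζ ^ (t : ℕ)) ^ s = 1).card ≤ s := by
  refine le_trans ?_ ((Multiset.toFinset_card_le _).trans (Polynomial.card_nthRoots s c⁻¹))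
  refine Finset.card_le_card_of_injOn (fun t => ζ ^ (t : ℕ)) (fun t ht => ?_) fun t _ t' _ h =>
    Fin.ext (hζ.pow_inj t.2 t'.2 h)
  simp only [Finset.coe_filter, Finset.mem_univ, true_and, Set.mem_ofPred_eq] at ht
  simp only [Finset.mem_coe, Multiset.mem_toFinset, Polynomial.mem_nthRoots hs]
  exact eq_inv_of_mul_eq_one_right ht

/-- The root of unity `e^{2πi/N}`. -/
def rootN (N : ℕ) : ℂ := Complex.exp (2 * Real.pi * Complex.I / N)

theorem fourier_apply (m n : Fin N) : fourier N m n =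
    (1 / (√N : ℂ)) * rootN N ^ (((m : ℕ) + 1) * ((n : ℕ) + 1)) := rfl

theorem fourier_comm (m n : Fin N) : fourier N m n = fourier N n m := by
  rw [fourier_apply, fourier_apply, mul_comm (_ + 1)]

variable [NeZero N]

theorem isPrimitiveRoot_rootN : IsPrimitiveRoot (rootN N) N :=
  Complex.isPrimitiveRoot_exp N (NeZero.ne N)

theorem fourier_add_one (m n : Fin N) :
    fourier N m (n + 1) = fourier N m n * rootN N ^ ((m : ℕ) + 1) := by
  have hroot : (rootN N ^ ((m : ℕ) + 1)) ^ N = 1 := by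
    rw [← pow_mul, mul_comm, pow_mul, isPrimitiveRoot_rootN.pow_eq_one, one_pow]
  have hone : (rootN N ^ ((m : ℕ) + 1)) ^ ((1 : Fin N) : ℕ) = rootN N ^ ((m : ℕ) + 1) := by
    rw [Fin.val_one', ← pow_eq_pow_mod 1 hroot, pow_one]
  rw [fourier_apply, fourier_apply, pow_mul, pow_succ, pow_val_add hroot, hone, pow_mul,
    pow_succ (_ ^ _)]
  ring

theorem norm_fourier_apply (m n : Fin N) : ‖fourier N m n‖ = 1 / √N := by
  rw [fourier_apply, norm_mul, norm_pow, isPrimitiveRoot_rootN.norm'_eq_one (NeZero.ne N), one_pow,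
    mul_one, norm_div, norm_one, Complex.norm_real, Real.norm_of_nonneg (Real.sqrt_nonneg _)]

end Fourier

section Phase

variable {N : ℕ} {κ : Type*}

/-- The factor that multiplies the entries in row `m` of a tensor power of the Fourier matrix when
the column entries indexed by `S` all increase by one. -/
def phase (ζ : ℂ) (S : Finset κ) (m : κ → Fin N) : ℂ := ∏ x ∈ S, ζ ^ ((m x : ℕ) + 1)

theorem phase_add_const {ζ : ℂ} (hζ : ζ ^ N = 1) (S : Finset κ) (m : κ → Fin N) (t : Fin N) :
    phase ζ S (m + fun _ => t) = phase ζ S m * (ζ ^ (t : ℕ)) ^ S.card := by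
  rw [phase, phase, ← Finset.prod_const, ← Finset.prod_mul_distrib]
  refine Finset.prod_congr rfl fun x _ => ?_
  rw [Pi.add_apply, pow_succ, pow_val_add hζ, pow_succ]
  ring

/-- Along each orbit of the diagonal translations, `phase ζ S` takes the value one at most `#S`
times. -/
theorem card_mul_card_phase_eq_one_le [NeZero N] {ζ : ℂ} (hζ : IsPrimitiveRoot ζ N) {S : Finset κ}
    (hS : S.Nonempty) {A : Finset (κ → Fin N)} (hA : ∀ m t, (m + fun _ => t) ∈ A ↔ m ∈ A) :
    N * (A.filter fun m => phase ζ S m = 1).card ≤ S.card * A.card := by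
  classical
  have htranslate (t : Fin N) : (A.filter fun m => phase ζ S m = 1).card =
      (A.filter fun m => phase ζ S m * (ζ ^ (t : ℕ)) ^ S.card = 1).card := by
    symm
    refine Finset.card_equiv (Equiv.addRight fun _ => t) fun m => ?_
    simp only [Finset.mem_filter, Equiv.coe_addRight, hA, phase_add_const hζ.pow_eq_one]
  calc N * (A.filter fun m => phase ζ S m = 1).card
      = ∑ t : Fin N, (A.filter fun m => phase ζ S m * (ζ ^ (t : ℕ)) ^ S.card = 1).card := by
        rw [← Finset.sum_congr rfl fun t _ => htranslate t]; simp
    _ = ∑ m ∈ A, (Finset.univ.filter fun t : Fin N =>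
          phase ζ S m * (ζ ^ (t : ℕ)) ^ S.card = 1).card := by
        simp_rw [Finset.card_filter]
        exact Finset.sum_comm
    _ ≤ ∑ _m ∈ A, S.card := Finset.sum_le_sum fun m _ =>
        card_mul_pow_eq_one_le hζ _ hS.card_pos
    _ = S.card * A.card := by rw [Finset.sum_const, smul_eq_mul, mul_comm]

variable [Fintype κ] [NeZero N] {K : κ → Matrix (Fin N) (Fin N) ℂ} {ζ : ℂ} {S : Finset κ}
  {r : Setoid κ}

theorem tensor_add_indicator (hK : ∀ x ∈ S, ∀ m n, K x m (n + 1) = K x m n * ζ ^ ((m : ℕ) + 1))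
    (m i : κ → Fin N) :
    tensor K m (i + Set.indicator S 1) = tensor K m i * phase ζ S m := by
  classical
  rw [tensor_apply, tensor_apply, phase, ← Finset.univ_inter S, ← Finset.prod_ite_mem,
    ← Finset.prod_mul_distrib]
  refine Finset.prod_congr rfl fun x _ => ?_
  by_cases hx : x ∈ S
  · simp [hx, hK]
  · simp [hx]

variable [DecidableEq κ]

theorem add_indicator_mem_constTuples (hS : ∀ ⦃x y⦄, r x y → (x ∈ S ↔ y ∈ S)) (i : κ → Fin N) :
    i + Set.indicator S 1 ∈ constTuples (Fin N) r ↔ i ∈ constTuples (Fin N) r := by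
  simp only [mem_constTuples, Setoid.le_def, Setoid.ker_def, Pi.add_apply]
  refine forall₃_congr fun x y hxy => ?_
  by_cases hx : x ∈ S
  · simp [hx, (hS hxy).1 hx]
  · simp [hx, mt (hS hxy).2 hx]

theorem sum_constTuples_eq_zero (hS : ∀ ⦃x y⦄, r x y → (x ∈ S ↔ y ∈ S))
    (hK : ∀ x ∈ S, ∀ m n, K x m (n + 1) = K x m n * ζ ^ ((m : ℕ) + 1)) {m : κ → Fin N}
    (hm : phase ζ S m ≠ 1) : ∑ i ∈ constTuples (Fin N) r, tensor K m i = 0 := by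
  have hshift : (∑ i ∈ constTuples (Fin N) r, tensor K m i) * phase ζ S m =
      ∑ i ∈ constTuples (Fin N) r, tensor K m i := by
    rw [Finset.sum_mul]
    refine Finset.sum_equiv (Equiv.addRight (Set.indicator S 1))
      (fun i => (add_indicator_mem_constTuples hS i).symm) fun i _ => ?_
    exact (tensor_add_indicator hK m i).symm
  exact (mul_right_eq_self₀.1 hshift).resolve_left hm

theorem inner_indVec_filter_phase (hS : ∀ ⦃x y⦄, r x y → (x ∈ S ↔ y ∈ S))
    (hK : ∀ x ∈ S, ∀ m n, K x m (n + 1) = K x m n * ζ ^ ((m : ℕ) + 1))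
    (A : Finset (κ → Fin N)) :
    inner ℂ (indVec A) (Matrix.toEuclideanCLM (𝕜 := ℂ) (tensor K)
      (indVec (constTuples (Fin N) r))) =
    inner ℂ (indVec (A.filter fun m => phase ζ S m = 1))
      (Matrix.toEuclideanCLM (𝕜 := ℂ) (tensor K) (indVec (constTuples (Fin N) r))) := by
  rw [inner_indVec_toEuclideanCLM_indVec, inner_indVec_toEuclideanCLM_indVec,
    Finset.sum_filter_of_ne]
  exact fun m _ => not_imp_comm.1 (sum_constTuples_eq_zero hS hK)

theorem norm_indVec_filter_phase_le (hζ : IsPrimitiveRoot ζ N) (hS₀ : S.Nonempty)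
    {A : Finset (κ → Fin N)} (hA : ∀ m t, (m + fun _ => t) ∈ A ↔ m ∈ A) :
    ‖indVec (A.filter fun m => phase ζ S m = 1)‖ ≤ √(Fintype.card κ) / √N * ‖indVec A‖ := by
  have hN : (0 : ℝ) < N := Nat.cast_pos.2 (NeZero.pos N)
  refine norm_indVec_le_mul (by positivity) ?_
  rw [div_pow, Real.sq_sqrt hN.le, Real.sq_sqrt (Nat.cast_nonneg _), div_mul_eq_mul_div,
    le_div_iff₀' hN]
  exact_mod_cast (card_mul_card_phase_eq_one_le hζ hS₀ hA).trans
    (Nat.mul_le_mul_right _ S.card_le_univ)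

theorem norm_indVec_constTuples_le (hN : 2 * Nat.card (Quotient r) ^ 2 ≤ N) :
    ‖indVec (constTuples (Fin N) r)‖ ≤ √2 * ‖indVec (exactTuples (Fin N) r)‖ := by
  refine norm_indVec_le_mul (Real.sqrt_nonneg 2) ?_
  rw [Real.sq_sqrt zero_le_two]
  exact mod_cast card_constTuples_le (hN.trans_eq (Fintype.card_fin N).symm)

theorem norm_indVec_constTuples_sdiff_le (r : Setoid κ) :
    ‖indVec (constTuples (Fin N) r \ exactTuples (Fin N) r)‖ ≤
      Fintype.card κ / √N * ‖indVec (constTuples (Fin N) r)‖ := by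
  have hN : (0 : ℝ) < N := Nat.cast_pos.2 (NeZero.pos N)
  refine norm_indVec_le_mul (by positivity) ?_
  rw [div_pow, Real.sq_sqrt hN.le, div_mul_eq_mul_div, le_div_iff₀' hN]
  have hcount := card_mul_card_constTuples_sdiff_le (α := Fin N) r
  rw [Fintype.card_fin] at hcount
  exact_mod_cast hcount.trans (Nat.mul_le_mul_right _ (Nat.pow_le_pow_left (card_quotient_le r) 2))

/-- The indicator of `constTuples r` is mapped into the span of the few tuples of phase one, and
`exactTuples r` is almost all of `constTuples r`. -/
theorem norm_inner_tensor_le (hζ : IsPrimitiveRoot ζ N) (hS₀ : S.Nonempty)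
    (hS : ∀ ⦃x y⦄, r x y → (x ∈ S ↔ y ∈ S))
    (hK : ∀ x ∈ S, ∀ m n, K x m (n + 1) = K x m n * ζ ^ ((m : ℕ) + 1))
    (hT : ∀ v, ‖Matrix.toEuclideanCLM (𝕜 := ℂ) (tensor K) v‖ ≤ ‖v‖)
    (hN : 2 * Nat.card (Quotient r) ^ 2 ≤ N) {A : Finset (κ → Fin N)}
    (hA : ∀ m t, (m + fun _ => t) ∈ A ↔ m ∈ A) :
    ‖(inner ℂ (indVec A) (Matrix.toEuclideanCLM (𝕜 := ℂ) (tensor K)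
      (indVec (exactTuples (Fin N) r))) : ℂ)‖ ≤
    √2 * (√(Fintype.card κ) + Fintype.card κ) / √N *
      (‖indVec A‖ * ‖indVec (exactTuples (Fin N) r)‖) := by
  set T := Matrix.toEuclideanCLM (𝕜 := ℂ) (tensor K)
  set n := Fintype.card κ
  set E := exactTuples (Fin N) r
  set C := constTuples (Fin N) r
  set A' := A.filter fun m => phase ζ S m = 1
  have hsplit : (inner ℂ (indVec A) (T (indVec E)) : ℂ) =
      inner ℂ (indVec A') (T (indVec C)) - inner ℂ (indVec A) (T (indVec (C \ E))) := by
    rw [← inner_indVec_filter_phase hS hK A,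
      ← indVec_add_indVec_sdiff (exactTuples_subset_constTuples r), map_add, inner_add_right,
      add_sub_cancel_right]
  calc ‖(inner ℂ (indVec A) (T (indVec E)) : ℂ)‖
      ≤ ‖indVec A'‖ * ‖T (indVec C)‖ + ‖indVec A‖ * ‖T (indVec (C \ E))‖ := by
        rw [hsplit]
        exact (norm_sub_le _ _).trans (add_le_add (norm_inner_le_norm _ _) (norm_inner_le_norm _ _))
    _ ≤ ‖indVec A'‖ * ‖indVec C‖ + ‖indVec A‖ * ‖indVec (C \ E)‖ := by gcongr <;> exact hT _
    _ ≤ √n / √N * ‖indVec A‖ * ‖indVec C‖ + ‖indVec A‖ * (n / √N * ‖indVec C‖) := by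
        gcongr
        · exact norm_indVec_filter_phase_le hζ hS₀ hA
        · exact norm_indVec_constTuples_sdiff_le r
    _ = (√n + n) / √N * ‖indVec A‖ * ‖indVec C‖ := by ring
    _ ≤ (√n + n) / √N * ‖indVec A‖ * (√2 * ‖indVec E‖) := by
        gcongr
        exact norm_indVec_constTuples_le hN
    _ = √2 * (√n + n) / √N * (‖indVec A‖ * ‖indVec E‖) := by ring

end Phase

section Overlap

variable {ι κ : Type*} [Fintype ι] [DecidableEq ι] [Fintype κ] [DecidableEq κ] {N : ℕ}
  {r r₁ r₂ : Setoid (ι ⊕ ι)}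

/-- The unnormalised uniform superposition of the basis vectors in `exactTuples (Fin N) r`. -/
abbrev exactVec (N : ℕ) (r : Setoid κ) : EuclideanSpace ℂ (κ → Fin N) :=
  indVec (exactTuples (Fin N) r)

/-- The operator `𝓕^{⊗ι} ⊗ (𝓕^*)^{⊗ι}` on `(ℂᴺ)^{⊗(ι ⊕ ι)}`. -/
abbrev fourierOp (ι : Type*) [Fintype ι] [DecidableEq ι] (N : ℕ) : TensorOp ι (Fin N) :=
  mixedRep ι (Fin N) (fourierU N)

/-- The tensor factors of `fourierOp ι N`. -/
def fourierFactor (ι : Type*) (N : ℕ) : ι ⊕ ι → Matrix (Fin N) (Fin N) ℂ :=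
  Sum.elim (fun _ => fourier N) fun _ => (fourier N).map star

theorem fourierOp_eq : fourierOp ι N =
    Matrix.toEuclideanCLM (𝕜 := ℂ) (mixedPow ι (Fin N) (fourierU N)) := rfl

theorem norm_fourierOp_apply (v : TensorSpace ι (Fin N)) : ‖fourierOp ι N v‖ = ‖v‖ :=
  ContinuousLinearMap.norm_map_of_mem_unitary (mixedRep ι (Fin N) (fourierU N)).2 v

theorem inner_fourierOp_comm (A C : Finset (ι ⊕ ι → Fin N)) :
    (inner ℂ (indVec A) (fourierOp ι N (indVec C)) : ℂ) =
      inner ℂ (indVec C) (fourierOp ι N (indVec A)) := by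
  have hsymm (m i : ι ⊕ ι → Fin N) :
      mixedPow ι (Fin N) (fourierU N) m i = mixedPow ι (Fin N) (fourierU N) i m := by
    simp only [mixedPow_apply, fourierU, fourier_comm]
  rw [fourierOp_eq, inner_indVec_toEuclideanCLM_indVec, inner_indVec_toEuclideanCLM_indVec]
  exact Finset.sum_comm.trans
    (Finset.sum_congr rfl fun i _ => Finset.sum_congr rfl fun j _ => hsymm j i)

theorem add_const_mem_exactTuples (r : Setoid κ)
    (m : κ → Fin N) (t : Fin N) :
    (m + fun _ => t) ∈ exactTuples (Fin N) r ↔ m ∈ exactTuples (Fin N) r := by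
  rw [mem_exactTuples, mem_exactTuples]
  refine iff_of_eq (congrArg (· = r) (Setoid.ext fun x y => ?_))
  exact add_left_inj t

variable [NeZero N]

theorem norm_mixedPow_fourier_apply (m i : ι ⊕ ι → Fin N) :
    ‖mixedPow ι (Fin N) (fourierU N) m i‖ = 1 / (N : ℝ) ^ Fintype.card ι := by
  have hN : (√(N : ℝ))⁻¹ * (√(N : ℝ))⁻¹ = (N : ℝ)⁻¹ := by
    rw [← mul_inv, Real.mul_self_sqrt (Nat.cast_nonneg N)]
  simp only [mixedPow_apply, fourierU, norm_mul, norm_prod, norm_star, norm_fourier_apply,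
    Finset.prod_const, Finset.card_univ, one_div]
  rw [← mul_pow, hN, inv_pow]

theorem sqrt_two_mul_add_le {k : ℕ} (hk : 1 ≤ k) :
    √2 * (√(2 * (k : ℝ)) + 2 * (k : ℝ)) ≤ 5 * k := by
  have hsqrt : √(k : ℝ) ≤ k := Real.sqrt_le_self_iff.2 (.inr (by exact_mod_cast hk))
  have htwo : √(2 : ℝ) ≤ 3 / 2 := Real.sqrt_le_left (by norm_num) |>.2 (by norm_num)
  calc √2 * (√(2 * (k : ℝ)) + 2 * (k : ℝ)) = 2 * √k + 2 * √2 * k := by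
        rw [Real.sqrt_mul zero_le_two, mul_add, ← mul_assoc, Real.mul_self_sqrt zero_le_two]
        ring
    _ ≤ 2 * k + 2 * (3 / 2) * k := by gcongr
    _ = 5 * k := by ring

theorem norm_inner_fourierOp_le_of_twisted {ζ : ℂ} (hζ : IsPrimitiveRoot ζ N) {y : ι ⊕ ι}
    (hy : ∀ x, r₂ x y → ∀ m n : Fin N,
      fourierFactor ι N x m (n + 1) = fourierFactor ι N x m n * ζ ^ ((m : ℕ) + 1))
    (hN : 8 * Fintype.card ι ^ 2 ≤ N) :
    ‖(inner ℂ (exactVec N r₁) (fourierOp ι N (exactVec N r₂)) : ℂ)‖ ≤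
    5 * Fintype.card ι / √N * (‖exactVec N r₁‖ * ‖exactVec N r₂‖) := by
  classical
  have hk : 1 ≤ Fintype.card ι := Fintype.card_pos_iff.2 ⟨y.elim id id⟩
  have hcard : Fintype.card (ι ⊕ ι) = 2 * Fintype.card ι := by rw [Fintype.card_sum, two_mul]
  have hq : Nat.card (Quotient r₂) ≤ 2 * Fintype.card ι := (card_quotient_le r₂).trans_eq hcard
  refine (norm_inner_tensor_le (S := Finset.univ.filter fun x => r₂ x y) hζ
    ⟨y, by simp⟩ (fun x z hxz => ?_) (fun x hx => hy x (by simpa using hx))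
    (fun v => (norm_fourierOp_apply v).le)
    (by nlinarith) (add_const_mem_exactTuples r₁)).trans ?_
  · simp only [Finset.mem_filter, Finset.mem_univ, true_and]
    exact ⟨r₂.trans (r₂.symm hxz), r₂.trans hxz⟩
  have hsqrt := sqrt_two_mul_add_le hk
  rw [hcard, Nat.cast_mul, Nat.cast_two]
  gcongr

theorem norm_inner_fourierOp_le_of_exists
    (h : (∃ y, ∀ x, ¬ r₂ (.inl x) y) ∨ ∃ y, ∀ x, ¬ r₂ (.inr x) y)
    (hN : 8 * Fintype.card ι ^ 2 ≤ N) :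
    ‖(inner ℂ (exactVec N r₁) (fourierOp ι N (exactVec N r₂)) : ℂ)‖ ≤
    5 * Fintype.card ι / √N * (‖exactVec N r₁‖ * ‖exactVec N r₂‖) := by
  rcases h with ⟨y, hy⟩ | ⟨y, hy⟩
  · refine norm_inner_fourierOp_le_of_twisted (y := y) (ζ := star (rootN N))
      (isPrimitiveRoot_rootN.map_of_injective (f := starRingEnd ℂ) (RingHom.injective _)) ?_ hN
    rintro (x | x) hx m n
    · exact absurd hx (hy x)
    · exact (congrArg star (fourier_add_one m n)).trans <|
        (star_mul' _ _).trans (congrArg _ (star_pow _ _))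
  · refine norm_inner_fourierOp_le_of_twisted (y := y) isPrimitiveRoot_rootN ?_ hN
    rintro (x | x) hx m n
    · exact fourier_add_one m n
    · exact absurd hx (hy x)

theorem norm_sq_exactVec_le (h : Nat.card (Quotient r) < Fintype.card ι) :
    ‖exactVec N r‖ ^ 2 ≤ (N : ℝ) ^ (Fintype.card ι - 1) := by
  rw [norm_sq_indVec, card_exactTuples, Fintype.card_fin]
  exact_mod_cast (Nat.descFactorial_le_pow _ _).trans
    (Nat.pow_le_pow_right (NeZero.pos N) (Nat.le_sub_one_of_lt h))

theorem norm_inner_fourierOp_le_of_card_quotient_lt (h₁ : Nat.card (Quotient r₁) < Fintype.card ι)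
    (h₂ : Nat.card (Quotient r₂) < Fintype.card ι) :
    ‖(inner ℂ (exactVec N r₁) (fourierOp ι N (exactVec N r₂)) : ℂ)‖ ≤
    1 / N * (‖exactVec N r₁‖ * ‖exactVec N r₂‖) := by
  set a := ‖exactVec N r₁‖
  set b := ‖exactVec N r₂‖
  set k := Fintype.card ι
  have hN : (N : ℝ) ≠ 0 := Nat.cast_ne_zero.2 (NeZero.ne N)
  have hab : a * b ≤ (N : ℝ) ^ (k - 1) := by
    nlinarith [sq_nonneg (a - b), norm_sq_exactVec_le (N := N) h₁,
      norm_sq_exactVec_le (N := N) h₂]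
  have hentries : ‖(inner ℂ (exactVec N r₁) (fourierOp ι N (exactVec N r₂)) : ℂ)‖ ≤
      a ^ 2 * (b ^ 2 * (1 / (N : ℝ) ^ k)) := by
    rw [fourierOp_eq, inner_indVec_toEuclideanCLM_indVec, norm_sq_indVec, norm_sq_indVec]
    refine (norm_sum_le_of_le _ fun m _ => norm_sum_le_of_le _ fun i _ =>
      (norm_mixedPow_fourier_apply m i).le).trans_eq ?_
    rw [Finset.sum_const, Finset.sum_const, nsmul_eq_mul, nsmul_eq_mul]
  calc _ ≤ a ^ 2 * (b ^ 2 * (1 / (N : ℝ) ^ k)) := hentries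
    _ = a * b * (a * b) * (1 / (N : ℝ) ^ k) := by ring
    _ ≤ (N : ℝ) ^ (k - 1) * (a * b) * (1 / (N : ℝ) ^ k) := by gcongr
    _ = 1 / N * (a * b) := by
      rw [← pow_sub_one_mul (Nat.zero_lt_of_lt h₁).ne' (N : ℝ)]
      field_simp

theorem norm_inner_fourierOp_le (h₁ : ∀ σ, r₁ ≠ pairing σ) (h₂ : ∀ σ, r₂ ≠ pairing σ)
    (hN : 8 * Fintype.card ι ^ 2 ≤ N) :
    ‖(inner ℂ (exactVec N r₁) (fourierOp ι N (exactVec N r₂)) : ℂ)‖ ≤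
    5 * Fintype.card ι / √N * (‖exactVec N r₁‖ * ‖exactVec N r₂‖) := by
  have hsmall {r : Setoid (ι ⊕ ι)} (h : ∀ σ, r ≠ pairing σ)
      (hr : ¬ ((∃ y, ∀ x, ¬ r (.inl x) y) ∨ ∃ y, ∀ x, ¬ r (.inr x) y)) :
      Nat.card (Quotient r) < Fintype.card ι := by
    push Not at hr
    exact (exists_eq_pairing_or_card_quotient_lt hr.1 hr.2).resolve_left fun ⟨σ, hσ⟩ => h σ hσ
  by_cases hr₂ : (∃ y, ∀ x, ¬ r₂ (.inl x) y) ∨ ∃ y, ∀ x, ¬ r₂ (.inr x) y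
  · exact norm_inner_fourierOp_le_of_exists hr₂ hN
  by_cases hr₁ : (∃ y, ∀ x, ¬ r₁ (.inl x) y) ∨ ∃ y, ∀ x, ¬ r₁ (.inr x) y
  · rw [inner_fourierOp_comm, mul_comm ‖_‖]
    exact norm_inner_fourierOp_le_of_exists hr₁ hN
  refine (norm_inner_fourierOp_le_of_card_quotient_lt (hsmall h₁ hr₁) (hsmall h₂ hr₂)).trans ?_
  have hk : (1 : ℝ) ≤ Fintype.card ι := by exact_mod_cast (Nat.zero_le _).trans_lt (hsmall h₁ hr₁)
  have hN1 : (1 : ℝ) ≤ N := by exact_mod_cast NeZero.one_le (n := N)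
  gcongr
  · linarith
  · exact Real.sqrt_le_self_iff.2 (.inr hN1)

end Overlap

section Orthogonal

variable {E R : Type*} [NormedAddCommGroup E] [InnerProductSpace ℂ E]

theorem norm_sq_sum_of_pairwise_inner_eq_zero {w : R → E}
    (hw : Pairwise fun r s => (inner ℂ (w r) (w s) : ℂ) = 0) (s : Finset R) :
    ‖∑ r ∈ s, w r‖ ^ 2 = ∑ r ∈ s, ‖w r‖ ^ 2 := by
  classical
  induction s using Finset.induction_on with
  | empty => simp
  | insert a s ha ih =>
    have horth : (inner ℂ (w a) (∑ r ∈ s, w r) : ℂ) = 0 := by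
      rw [inner_sum]
      exact Finset.sum_eq_zero fun r hr => hw fun h => ha (h ▸ hr)
    rw [Finset.sum_insert ha, Finset.sum_insert ha, ← ih, sq, sq, sq,
      norm_add_sq_eq_norm_sq_add_norm_sq_of_inner_eq_zero _ _ horth]

theorem norm_inner_sum_map_sum_le {T : E →L[ℂ] E} {w : R → E} {s : Finset R} {δ : ℝ} (hδ : 0 ≤ δ)
    (h : ∀ r ∈ s, ∀ r' ∈ s, ‖(inner ℂ (w r) (T (w r')) : ℂ)‖ ≤ δ * (‖w r‖ * ‖w r'‖)) :
    ‖(inner ℂ (∑ r ∈ s, w r) (T (∑ r ∈ s, w r)) : ℂ)‖ ≤ δ * (s.card * ∑ r ∈ s, ‖w r‖ ^ 2) := by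
  calc ‖(inner ℂ (∑ r ∈ s, w r) (T (∑ r ∈ s, w r)) : ℂ)‖
      ≤ ∑ r ∈ s, ∑ r' ∈ s, δ * (‖w r‖ * ‖w r'‖) := by
        rw [map_sum, sum_inner]
        refine norm_sum_le_of_le _ fun r hr => ?_
        rw [inner_sum]
        exact norm_sum_le_of_le _ fun r' hr' => h r hr r' hr'
    _ = δ * (∑ r ∈ s, ‖w r‖) ^ 2 := by
        rw [sq, Finset.sum_mul_sum, Finset.mul_sum]
        simp only [Finset.mul_sum]
    _ ≤ δ * (s.card * ∑ r ∈ s, ‖w r‖ ^ 2) := by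
        gcongr
        exact sq_sum_le_card_mul_sum_sq

theorem norm_inner_map_le_of_orthogonal_decomposition [Fintype R] {T : E →L[ℂ] E}
    (hT : ∀ v, ‖T v‖ = ‖v‖) {w : R → E}
    (hw : Pairwise fun r s => (inner ℂ (w r) (w s) : ℂ) = 0) (s : Finset R) {δ η : ℝ} (hδ : 0 ≤ δ)
    (hη : 0 ≤ η) (hsmall : ∀ r ∉ s, ‖w r‖ ≤ η * ‖∑ r, w r‖)
    (h : ∀ r ∈ s, ∀ r' ∈ s, ‖(inner ℂ (w r) (T (w r')) : ℂ)‖ ≤ δ * (‖w r‖ * ‖w r'‖)) :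
    ‖(inner ℂ (∑ r, w r) (T (∑ r, w r)) : ℂ)‖ ≤
      (δ + 2 * η) * Fintype.card R * ‖∑ r, w r‖ ^ 2 := by
  classical
  have hpyth := norm_sq_sum_of_pairwise_inner_eq_zero hw
  set v := ∑ r, w r
  set g := ∑ r ∈ s, w r
  set b := ∑ r ∈ sᶜ, w r
  have hv : v = g + b := (Finset.sum_add_sum_compl s w).symm
  have hsum : ∑ r ∈ s, ‖w r‖ ^ 2 ≤ ‖v‖ ^ 2 := by
    rw [hpyth]
    exact Finset.sum_le_univ_sum_of_nonneg fun r => sq_nonneg _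
  have hg : ‖g‖ ≤ ‖v‖ := le_of_sq_le_sq ((hpyth s).trans_le hsum) (norm_nonneg _)
  have hb : ‖b‖ ≤ (Fintype.card R : ℝ) * (η * ‖v‖) := by
    refine (norm_sum_le_of_le _ fun r hr => hsmall r (Finset.mem_compl.1 hr)).trans ?_
    rw [Finset.sum_const, nsmul_eq_mul]
    gcongr
    exact_mod_cast Finset.card_le_univ _
  have hgg : ‖(inner ℂ g (T g) : ℂ)‖ ≤ δ * (Fintype.card R * ‖v‖ ^ 2) := by
    refine (norm_inner_sum_map_sum_le hδ h).trans ?_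
    gcongr
    exact_mod_cast Finset.card_le_univ _
  calc ‖(inner ℂ v (T v) : ℂ)‖ = ‖(inner ℂ g (T g) + inner ℂ g (T b) + inner ℂ b (T v) : ℂ)‖ := by
        rw [← inner_add_right, ← map_add, ← hv, ← inner_add_left, ← hv]
    _ ≤ ‖(inner ℂ g (T g) : ℂ)‖ + ‖g‖ * ‖T b‖ + ‖b‖ * ‖T v‖ :=
        norm_add₃_le.trans <| by
          gcongr <;> exact norm_inner_le_norm _ _
    _ ≤ δ * (Fintype.card R * ‖v‖ ^ 2) + ‖v‖ * (Fintype.card R * (η * ‖v‖)) +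
          Fintype.card R * (η * ‖v‖) * ‖v‖ := by
        rw [hT, hT]
        gcongr
    _ = (δ + 2 * η) * Fintype.card R * ‖v‖ ^ 2 := by ring

end Orthogonal

section Invariant

variable {ι : Type*} [Fintype ι] [DecidableEq ι] {N : ℕ}

theorem mixedPow_B_apply (π : Equiv.Perm (Fin N)) (i j : ι ⊕ ι → Fin N) :
    mixedPow ι (Fin N) (B π) i j = if i = π ∘ j then 1 else 0 := by
  have hB : Sum.elim (fun _ => B π) (fun _ => (B π).map star) = fun _ : ι ⊕ ι => B π := by
    rw [map_star_B]
    exact Sum.elim_const_const _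
  rw [mixedPow_eq_tensor, hB, tensor_apply]
  simp only [B, Matrix.of_apply, Finset.prod_ite_zero, Finset.prod_const_one, Finset.mem_univ,
    true_imp_iff, funext_iff, Function.comp_apply]

theorem mixedRep_permU_apply_comp (π : Equiv.Perm (Fin N)) (v : TensorSpace ι (Fin N))
    (i : ι ⊕ ι → Fin N) :
    (mixedRep ι (Fin N) (permU π) : TensorOp ι (Fin N)) v (π ∘ i) = v i := by
  simp [coe_mixedRep, Matrix.ofLp_toEuclideanCLM, Matrix.mulVec, dotProduct, permU,
    mixedPow_B_apply, π.injective.comp_left.eq_iff]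

theorem sum_smul_exactVec_apply (c : Setoid (ι ⊕ ι) → ℂ) (i : ι ⊕ ι → Fin N) :
    (∑ r, c r • exactVec N r) i = c (Setoid.ker i) := by
  classical
  simp [indVec_apply, mem_exactTuples]

theorem exists_eq_sum_smul_exactVec {v : TensorSpace ι (Fin N)}
    (hv : ∀ π, (mixedRep ι (Fin N) (permU π) : TensorOp ι (Fin N)) v = v) :
    ∃ c : Setoid (ι ⊕ ι) → ℂ, v = ∑ r, c r • exactVec N r := by
  have hclass : Function.FactorsThrough v Setoid.ker := fun i j h => by
    obtain ⟨π, rfl⟩ := exists_perm_comp_eq h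
    rw [← mixedRep_permU_apply_comp π v i, hv]
  obtain ⟨c, hc⟩ := (Function.factorsThrough_iff _).1 hclass
  exact ⟨c, PiLp.ext fun i => (congrFun hc i).trans (sum_smul_exactVec_apply c i).symm⟩

theorem pairwise_inner_smul_exactVec (c : Setoid (ι ⊕ ι) → ℂ) :
    Pairwise fun r s => (inner ℂ (c r • exactVec N r) (c s • exactVec N s) : ℂ) = 0 := by
  intro r s hrs
  have horth : ∑ i ∈ exactTuples (Fin N) r, exactVec N s i = 0 :=
    Finset.sum_eq_zero fun i hi => if_neg fun hi' => hrs <|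
      (mem_exactTuples.1 hi).symm.trans (mem_exactTuples.1 hi')
  rw [inner_smul_left, inner_smul_right, inner_indVec, horth, mul_zero, mul_zero]

theorem sum_constTuples_pairing {α M : Type*} [Fintype α] [AddCommMonoid M] (σ : Equiv.Perm ι)
    (f : (ι ⊕ ι → α) → M) :
    ∑ i ∈ constTuples α (pairing σ), f i = ∑ j : ι → α, f (j ∘ Sum.elim id σ) := by
  refine (Finset.sum_nbij' (fun j => j ∘ Sum.elim id σ) (fun i => i ∘ Sum.inl)
    (fun j _ => mem_constTuples.2 fun x y hxy => congrArg j hxy) (fun i _ => Finset.mem_univ _)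
    (fun j _ => rfl) (fun i hi => ?_) fun j _ => rfl).symm
  funext x
  rcases x with x | x
  · rfl
  · exact pairing_le_ker.1 (mem_constTuples.1 hi) x

theorem sum_mixedPow_comp_pairing {n : Type*} [Fintype n] [DecidableEq n] {A : Matrix n n ℂ}
    (hA : A ∈ Matrix.unitaryGroup n ℂ) (σ : Equiv.Perm ι) (i : ι ⊕ ι → n) :
    ∑ j : ι → n, mixedPow ι n A i (j ∘ Sum.elim id σ) =
      if i ∈ constTuples n (pairing σ) then 1 else 0 := by
  have hentry (a b : n) : ∑ c, A a c * star (A b c) = if a = b then 1 else 0 := by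
    rw [← Matrix.one_apply, ← Matrix.mem_unitaryGroup_iff.1 hA, Matrix.mul_apply]
    rfl
  calc ∑ j : ι → n, mixedPow ι n A i (j ∘ Sum.elim id σ)
      = ∑ j : ι → n, ∏ x, A (i (.inl (σ x))) (j (σ x)) * star (A (i (.inr x)) (j (σ x))) := by
        refine Finset.sum_congr rfl fun j _ => ?_
        rw [mixedPow_apply, Finset.prod_mul_distrib, ← Equiv.prod_comp σ]
        rfl
    _ = ∑ j : ι → n, ∏ x, A (i (.inl (σ x))) (j x) * star (A (i (.inr x)) (j x)) :=
        Fintype.sum_equiv (σ.symm.arrowCongr (Equiv.refl n)) _ _ fun _ => rfl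
    _ = ∏ x, ∑ c, A (i (.inl (σ x))) c * star (A (i (.inr x)) c) := by
        rw [Fintype.prod_sum]
    _ = if i ∈ constTuples n (pairing σ) then 1 else 0 := by
        simp only [hentry, Finset.prod_ite_zero, Finset.prod_const_one, mem_constTuples,
          pairing_le_ker, Finset.mem_univ, true_imp_iff]

theorem mixedRep_indVec_constTuples_pairing (V : U N) (σ : Equiv.Perm ι) :
    (mixedRep ι (Fin N) V : TensorOp ι (Fin N)) (indVec (constTuples (Fin N) (pairing σ))) =
      indVec (constTuples (Fin N) (pairing σ)) := by
  ext i
  rw [coe_mixedRep, toEuclideanCLM_indVec_apply, sum_constTuples_pairing,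
    sum_mixedPow_comp_pairing V.2, indVec_apply]

end Invariant

section Gap

variable {N k : ℕ}

theorem two_mul_pow_lt_sqrt_of_epsA_pos (hN : 0 < N) (hA : 0 < epsA N k) :
    2 * (2 * (k : ℝ)) ^ (4 * k) < √N := by
  rwa [epsA, sub_pos, div_lt_one (Real.sqrt_pos.2 (Nat.cast_pos.2 hN))] at hA

theorem moment_haar_indVec_constTuples_pairing (σ : Equiv.Perm (Fin k)) :
    moment k (haar N) (indVec (constTuples (Fin N) (pairing σ))) =
      indVec (constTuples (Fin N) (pairing σ)) := by
  simp [moment, ContinuousLinearMap.integral_apply (integrable_mixedRep k (haar N)),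
    mixedRep_indVec_constTuples_pairing]

theorem sum_constTuples_pairing_eq_zero {v : TensorSpace (Fin k) (Fin N)}
    (hv : moment k (haar N) v = 0) (σ : Equiv.Perm (Fin k)) :
    ∑ i ∈ constTuples (Fin N) (pairing σ), v i = 0 := by
  have hsymm := (isStarProjection_moment_haar N k).isSelfAdjoint.isSymmetric
  rw [← inner_indVec, ← moment_haar_indVec_constTuples_pairing]
  exact (hsymm _ _).trans (by rw [ContinuousLinearMap.coe_coe, hv, inner_zero_right])

theorem exists_eq_sum_smul_exactVec_of_permMoment {v : TensorSpace (Fin k) (Fin N)}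
    (hv : permMoment N k v = v) :
    ∃ c : Setoid (Fin k ⊕ Fin k) → ℂ, v = ∑ r, c r • exactVec N r := by
  refine exists_eq_sum_smul_exactVec fun π => ?_
  conv_lhs => rw [← hv]
  conv_rhs => rw [← hv, ← mixedRep_permU_mul_permMoment k π]
  rfl

variable [NeZero N]

theorem norm_smul_exactVec_pairing_le (hN : 2 * k ^ 2 ≤ N) {c : Setoid (Fin k ⊕ Fin k) → ℂ}
    (hv : moment k (haar N) (∑ r, c r • exactVec N r) = 0) (σ : Equiv.Perm (Fin k)) :
    ‖c (pairing σ) • exactVec N (pairing σ)‖ ≤ √2 * k / √N * ‖∑ r, c r • exactVec N r‖ := by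
  set v := ∑ r, c r • exactVec N r
  have hvc {i : Fin k ⊕ Fin k → Fin N} (hi : i ∈ exactTuples (Fin N) (pairing σ)) :
      v i = c (pairing σ) := by
    rw [sum_smul_exactVec_apply, mem_exactTuples.1 hi]
  have hq : Nat.card (Quotient (pairing σ)) = k := by rw [card_quotient_pairing, Fintype.card_fin]
  have hbound := card_mul_sum_exactTuples_le (by rwa [hq, Fintype.card_fin]) (fun _ => hvc)
    (sum_constTuples_pairing_eq_zero hv σ)
  have hnorm : ‖c (pairing σ) • exactVec N (pairing σ)‖ ^ 2 =
      ∑ i ∈ exactTuples (Fin N) (pairing σ), ‖v i‖ ^ 2 := by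
    rw [Finset.sum_congr rfl fun i hi => by rw [hvc hi], Finset.sum_const, nsmul_eq_mul, norm_smul,
      mul_pow, norm_sq_indVec, mul_comm]
  rw [Fintype.card_fin, hq, ← hnorm, ← EuclideanSpace.norm_sq_eq] at hbound
  refine le_of_sq_le_sq ?_ (by positivity)
  rw [mul_pow, div_pow, mul_pow, Real.sq_sqrt zero_le_two, Real.sq_sqrt (Nat.cast_nonneg N),
    div_mul_eq_mul_div, le_div_iff₀ (Nat.cast_pos.2 (NeZero.pos N)), mul_comm]
  exact hbound

theorem eight_mul_sq_le_of_epsA_pos (hA : 0 < epsA N k) : 8 * k ^ 2 ≤ N := by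
  rcases Nat.eq_zero_or_pos k with rfl | hk
  · simp
  have hk1 : (1 : ℝ) ≤ k := by exact_mod_cast hk
  have hsqrt := two_mul_pow_lt_sqrt_of_epsA_pos (NeZero.pos N) hA
  have hpow : 2 * (k : ℝ) ≤ (2 * k : ℝ) ^ (4 * k) := le_self_pow₀ (by linarith) (by omega)
  have hle : (4 * (k : ℝ)) ^ 2 ≤ N := Real.le_sqrt' (by positivity) |>.1 (by linarith)
  have : 8 * (k : ℝ) ^ 2 ≤ N := by nlinarith
  exact_mod_cast this

theorem mul_card_setoid_le (k : ℕ) :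
    (5 * k + 2 * (√2 * k)) * Fintype.card (Setoid (Fin k ⊕ Fin k)) ≤
      2 * (2 * (k : ℝ)) ^ (4 * k) := by
  rcases Nat.eq_zero_or_pos k with rfl | hk
  · simp
  have hk1 : (1 : ℝ) ≤ k := by exact_mod_cast hk
  have hcard : (Fintype.card (Setoid (Fin k ⊕ Fin k)) : ℝ) ≤ (2 * k) ^ (2 * k) := by
    have h := card_setoid_le (ι := Fin k ⊕ Fin k)
    rw [Fintype.card_sum, Fintype.card_fin, ← two_mul] at h
    exact_mod_cast h
  have htwo : √(2 : ℝ) ≤ 3 / 2 := Real.sqrt_le_left (by norm_num) |>.2 (by norm_num)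
  have hpow : (2 * (k : ℝ)) ^ 2 ≤ (2 * k) ^ (2 * k) := pow_le_pow_right₀ (by linarith) (by omega)
  have hfactor : 5 * (k : ℝ) + 2 * (√2 * k) ≤ 2 * (2 * k) ^ (2 * k) := by nlinarith
  calc (5 * k + 2 * (√2 * k)) * (Fintype.card (Setoid (Fin k ⊕ Fin k)) : ℝ)
      ≤ 2 * (2 * k) ^ (2 * k) * (2 * k) ^ (2 * k) := by gcongr
    _ = 2 * (2 * (k : ℝ)) ^ (4 * k) := by ring

theorem norm_inner_smul_fourierOp_le (hN : 8 * k ^ 2 ≤ N) (c : Setoid (Fin k ⊕ Fin k) → ℂ)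
    {r s : Setoid (Fin k ⊕ Fin k)} (hr : ∀ σ, r ≠ pairing σ) (hs : ∀ σ, s ≠ pairing σ) :
    ‖(inner ℂ (c r • exactVec N r) (fourierOp (Fin k) N (c s • exactVec N s)) : ℂ)‖ ≤
      5 * k / √N * (‖c r • exactVec N r‖ * ‖c s • exactVec N s‖) := by
  have h := norm_inner_fourierOp_le (N := N) hr hs (by rwa [Fintype.card_fin])
  rw [Fintype.card_fin] at h
  rw [map_smul, inner_smul_left, inner_smul_right, norm_mul, norm_mul, RCLike.norm_conj, norm_smul,
    norm_smul]
  calc _ = ‖c r‖ * ‖c s‖ *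
        ‖(inner ℂ (exactVec N r) (fourierOp (Fin k) N (exactVec N s)) : ℂ)‖ := by ring
    _ ≤ ‖c r‖ * ‖c s‖ * (5 * k / √N * (‖exactVec N r‖ * ‖exactVec N s‖)) := by gcongr
    _ = _ := by ring

theorem re_inner_fourierOp_le (hA : 0 < epsA N k) {v : TensorSpace (Fin k) (Fin N)}
    (hG : moment k (haar N) v = 0) (hP : permMoment N k v = v) :
    (inner ℂ v (fourierOp (Fin k) N v)).re ≤ (1 - epsA N k) * ‖v‖ ^ 2 := by
  classical
  have hN := eight_mul_sq_le_of_epsA_pos hA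
  obtain ⟨c, rfl⟩ := exists_eq_sum_smul_exactVec_of_permMoment hP
  have hbound := norm_inner_map_le_of_orthogonal_decomposition norm_fourierOp_apply
    (pairwise_inner_smul_exactVec c) (Finset.univ.filter fun r => ∀ σ, r ≠ pairing σ)
    (δ := 5 * k / √N) (η := √2 * k / √N) (by positivity) (by positivity)
    (fun r hr => by
      obtain ⟨σ, rfl⟩ : ∃ σ, r = pairing σ := by simpa using hr
      exact norm_smul_exactVec_pairing_le (by linarith) hG σ)
    (fun r hr s hs => norm_inner_smul_fourierOp_le hN c (Finset.mem_filter.1 hr).2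
      (Finset.mem_filter.1 hs).2)
  refine (Complex.re_le_norm _).trans (hbound.trans ?_)
  rw [epsA, sub_sub_cancel]
  gcongr
  calc _ = (5 * k + 2 * (√2 * k)) * Fintype.card (Setoid (Fin k ⊕ Fin k)) / √N := by
        ring
    _ ≤ 2 * (2 * (k : ℝ)) ^ (4 * k) / √N :=
        div_le_div_of_nonneg_right (mul_card_setoid_le k) (Real.sqrt_nonneg _)

end Gap

section Main

variable {N D k : ℕ} {εC : ℝ} {νC : PMF (Equiv.Perm (Fin N))}

theorem IsClassicalTPE.lam_nonneg {lam : ℝ} (h : IsClassicalTPE N D lam k νC) : 0 ≤ lam :=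
  (norm_nonneg _).trans h.norm_le

theorem permU_injective : Function.Injective (permU : Equiv.Perm (Fin N) → U N) := by
  intro π τ h
  ext b
  have hentry := congr_fun₂ (congrArg Subtype.val h) (π b) b
  by_contra hne
  simp [permU, B, Fin.ext_iff, hne] at hentry

theorem permU_ne_fourierU (hN : 1 < N) (π : Equiv.Perm (Fin N)) : permU π ≠ fourierU N := by
  have : NeZero N := ⟨by omega⟩
  intro h
  have hentry : ‖B π (π 0) 0‖ = 1 / √N :=
    (congrArg norm (congr_fun₂ (congrArg Subtype.val h) (π 0) 0)).trans (norm_fourier_apply _ _)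
  have hN1 : N = 1 := by simpa [B] using hentry
  omega

theorem support_nuQ {p : ℝ} (hp : p ∈ Set.Ioo (0 : ℝ) 1) (νC : PMF (Equiv.Perm (Fin N))) :
    (nuQ p (Set.Ioo_subset_Icc_self hp) νC).support =
      insert (fourierU N) (permU '' νC.support) := by
  ext V
  have hmix : nuQ p (Set.Ioo_subset_Icc_self hp) νC V =
      ENNReal.ofReal p * (νC.map permU) V + ENNReal.ofReal (1 - p) * PMF.pure (fourierU N) V := rfl
  have hp0 : ¬ p ≤ 0 := not_le.2 hp.1
  have hp1 : ¬ 1 - p ≤ 0 := not_le.2 (sub_pos.2 hp.2)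
  rw [← PMF.support_map, PMF.mem_support_iff, hmix, Set.mem_insert_iff, PMF.mem_support_iff, Ne,
    add_eq_zero, mul_eq_zero, mul_eq_zero, ENNReal.ofReal_eq_zero, ENNReal.ofReal_eq_zero,
    PMF.pure_apply]
  by_cases hV : V = fourierU N <;> simp [hp0, hp1, hV]

theorem encard_support_nuQ_le {p : ℝ} (hp : p ∈ Set.Ioo (0 : ℝ) 1)
    (νC : PMF (Equiv.Perm (Fin N))) :
    (nuQ p (Set.Ioo_subset_Icc_self hp) νC).support.encard ≤ νC.support.encard + 1 := by
  rw [support_nuQ hp, ← permU_injective.encard_image]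
  exact Set.encard_insert_le _ _

theorem encard_support_nuQ (hN : 1 < N) {p : ℝ} (hp : p ∈ Set.Ioo (0 : ℝ) 1)
    (νC : PMF (Equiv.Perm (Fin N))) :
    (nuQ p (Set.Ioo_subset_Icc_self hp) νC).support.encard = νC.support.encard + 1 := by
  have hF : fourierU N ∉ permU '' νC.support := by
    rintro ⟨π, -, h⟩
    exact permU_ne_fourierU hN π h
  rw [support_nuQ hp, Set.encard_insert_of_notMem hF, permU_injective.encard_image]

theorem epsA_le_one (N k : ℕ) : epsA N k ≤ 1 :=
  sub_le_self _ (by positivity)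

theorem one_lt_of_epsA_pos (hN : 0 < N) (hA : 0 < epsA N k) : 1 < N := by
  have hsqrt := two_mul_pow_lt_sqrt_of_epsA_pos hN hA
  have hpow : (1 : ℝ) ≤ (2 * (k : ℝ)) ^ (4 * k) := by
    rcases Nat.eq_zero_or_pos k with rfl | hk
    · simp
    · exact one_le_pow₀ (by exact_mod_cast (by omega : 1 ≤ 2 * k))
  exact_mod_cast Real.lt_sqrt zero_le_one |>.1 (by linarith : 1 < √(N : ℝ))

theorem gapBound_pos (hC0 : 0 < εC) (hA : 0 < epsA N k) {p : ℝ} (hp : p ∈ Set.Ioo (0 : ℝ) 1) :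
    0 < gapBound N k εC p :=
  mul_pos (by linarith) (lt_min (mul_pos hp.1 hC0) (sub_pos.2 hp.2))

theorem isQuantumTPE_nuQ (hN : 0 < N) (hC : IsClassicalTPE N D (1 - εC) (2 * k) νC)
    (hA : 0 < epsA N k) {p : ℝ} (hp : p ∈ Set.Ioo (0 : ℝ) 1) :
    IsQuantumTPE N (D + 1) (1 - gapBound N k εC p) k
      (nuQ p (Set.Ioo_subset_Icc_self hp) νC) where
  support_le := (encard_support_nuQ_le hp νC).trans <| by
    push_cast
    gcongr
    exact hC.support_le
  norm_le := by
    have : NeZero N := ⟨hN.ne'⟩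
    rw [schattenInf_quantumMoment_sub]
    exact norm_moment_nuQ_sub_le hp (by linarith [hC.lam_lt_one]) hA.le (epsA_le_one N k)
      ((schattenInf_classicalMoment_sub k _ _).symm.trans_le hC.norm_le)
      fun _ hG hP => re_inner_fourierOp_le hA hG hP
  lam_lt_one := sub_lt_self _ (gapBound_pos (by linarith [hC.lam_lt_one]) hA hp)

theorem gapBound_optimal (hC0 : 0 < εC) :
    gapBound N k εC (1 / (1 + εC)) = epsA N k / 12 * (εC / (1 + εC)) := by
  have hbalance : 1 - 1 / (1 + εC) = 1 / (1 + εC) * εC := by field_simp; ring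
  rw [gapBound, hbalance, min_self, one_div_mul_eq_div]

theorem isMaxOn_gapBound (hC0 : 0 < εC) (hA : 0 ≤ epsA N k) :
    IsMaxOn (gapBound N k εC) Set.univ (1 / (1 + εC)) := by
  intro p _
  rw [Set.mem_ofPred_eq, gapBound_optimal hC0, gapBound]
  gcongr
  rw [le_div_iff₀ (by linarith)]
  nlinarith [min_le_left (p * εC) (1 - p), min_le_right (p * εC) (1 - p)]

theorem epsA_mul_div_le_gapBound_optimal (hC0 : 0 < εC) (hC1 : εC ≤ 1) (hA : 0 ≤ epsA N k) :
    epsA N k * εC / 24 ≤ gapBound N k εC (1 / (1 + εC)) := by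
  have hhalf : εC / 2 ≤ εC / (1 + εC) := by gcongr; linarith
  rw [gapBound_optimal hC0]
  nlinarith

end Main

end TPE

end

theorem theorem1p6 (N D k : ℕ) (hN : 0 < N) (εC : ℝ) (νC : PMF (Equiv.Perm (Fin N)))
    (hC : TPE.IsClassicalTPE N D (1 - εC) (2 * k) νC) (hA : 0 < TPE.epsA N k) :
    (∀ (p : ℝ) (hp : p ∈ Set.Ioo (0 : ℝ) 1),
      0 < TPE.gapBound N k εC p ∧
      (∃ εQ : ℝ, TPE.gapBound N k εC p ≤ εQ ∧
        TPE.IsQuantumTPE N (D + 1) (1 - εQ) k (TPE.nuQ p (Set.Ioo_subset_Icc_self hp) νC)) ∧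
      (νC.support.encard = D →
        (TPE.nuQ p (Set.Ioo_subset_Icc_self hp) νC).support.encard = D + 1)) ∧
    IsMaxOn (TPE.gapBound N k εC) (Set.Ioo (0 : ℝ) 1) (1 / (1 + εC)) ∧
    ∃ hp : 1 / (1 + εC) ∈ Set.Ioo (0 : ℝ) 1,
      ∃ εQ : ℝ, TPE.epsA N k * εC / 24 ≤ εQ ∧
        TPE.IsQuantumTPE N (D + 1) (1 - εQ) k
          (TPE.nuQ (1 / (1 + εC)) (Set.Ioo_subset_Icc_self hp) νC) := by
  have hC0 : 0 < εC := by linarith [hC.lam_lt_one]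
  have hp0 : 1 / (1 + εC) ∈ Set.Ioo (0 : ℝ) 1 :=
    ⟨by positivity, (div_lt_one (by linarith)).2 (by linarith)⟩
  refine ⟨fun p hp => ⟨TPE.gapBound_pos hC0 hA hp,
      ⟨_, le_rfl, TPE.isQuantumTPE_nuQ hN hC hA hp⟩, fun hD => ?_⟩,
    (TPE.isMaxOn_gapBound hC0 hA.le).on_subset (Set.subset_univ _), hp0,
    _, TPE.epsA_mul_div_le_gapBound_optimal hC0 (sub_nonneg.1 hC.lam_nonneg) hA.le,
    TPE.isQuantumTPE_nuQ hN hC hA hp0⟩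
  rw [TPE.encard_support_nuQ (TPE.one_lt_of_epsA_pos hN hA) hp, hD]
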